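/- **Setting.** Let $r,n\ge 0$ be integers. Fix an $r$-qubit CSS code, given by two subspaces $C_X,C_Z\subseteq\mathbb F_2^r$ with $s\cdot t=0$ for all $s\in C_X$, $t\in C_Z$; its stabilizers are $\bigotimes_j X^{s_j}$ ($s\in C_X$) and $\bigotimes_j Z^{s_j}$ ($s\in C_Z$), and its code space is their common $+1$ eigenspace. For each $i\in\{1,\dots,r\}$ fix $S^i\in C_X\cap C_Z$ with $S^i_i=1$. There are two kinds of queries to a prover. An $X$- or $Z$-query $(N,a,b)$, with $N\in\{X,Z\}$ and $a,b\in\{0,1\}^n$, is sent with $a,b$ in lexicographic order and is answered by two signs in $\{\pm1\}$, one for $a$ and one for $b$. A $W$-query $(N',a,b)$, with $N'\in\{X',Z'\}$ and $a,b\in\{0,1\}^n$, is answered by one sign. A *strategy* $(N,|\psi\rangle)$ consists of a unit vector $|\psi\rangle\in\mathcal H_1\otimes\dots\otimes\mathcal H_r$, with each $\mathcal H_i$ finite dimensional, and, for each prover $i$ and each query, a POVM on $\mathcal H_i$ with the corresponding answers as outcomes. *Encoding tests.* Choose a uniformly random *special prover* $i$; the others form the *composite prover*. Sending $\overline{(N,u,c)}$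 to the composite prover means: each $j\ne i$ with $S^i_j=1$ is sent $(N,u,c)$, every other $j\neq i$ is sent $(N,d_j,d_j')$ with independent uniformly random $d_j,d'_j$, and the composite answer to $u$ is the product of the answers to $u$ of the provers $j\ne i$ with $S^i_j=1$. Perform one of the following tests, each with probability $1/3$; all strings $a,b,c\in\{0,1\}^n$ and all basis settings are independent and uniformly random. 1. *Linearity test.* Choose $N\in\{X,Z\}$. The special prover is sent $(N,a,b)$ and answers $\alpha$ to $a$ and $\beta$ to $b$. The composite prover is sent $\overline{(N,a,c)}$, $\overline{(N,b,c)}$ or $\overline{(N,a+b,c)}$, each with probability $1/3$. Accept if the composite answer to the first string is $\alpha$, $\beta$, or $\alpha\beta$, respectively. 2. *Anticommutation test.* Choose $N\in\{X,Z\}$ and $N'\in\{X',Z'\}$. The special prover is sent $(N',a,b)$; the composite prover is sent $\overline{(X,a,c)}$ if $N=X$ and $\overline{(Z,b,c)}$ if $N=Z$. Accept if $a\cdot b=0 \bmod 2$. Otherwise accept if the product of the special prover's answer and the composite answer to $a$ (resp. $b$) is $-1$ in case $(N',N)=(Z',Z)$, and if it is $+1$ in the other cases. 3. *Stabilizer test.*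 Choose $N\in\{X,Z\}$. The special prover is sent $(N,a,b)$, the composite prover $\overline{(N,a,c)}$. Accept if the product of the special prover's and the composite answers to $a$ is $+1$. *Honest strategy.* Each prover holds $n$ qubits. The state is a unit vector such that for each $k\in\{1,\dots,n\}$ the $k$-th qubits of the $r$ provers are in the code space. On $(N,a,b)$ with $N\in\{X,Z\}$, measure the commuting observables $N(a)$ and $N(b)$, where $X(a)=\bigotimes_kX^{a_k}$ and $Z(b)=\bigotimes_kZ^{b_k}$. On $(X',a,b)$, respectively $(Z',a,b)$, measure $(X(a)+Z(b))/\sqrt2$, respectively $(X(a)-Z(b))/\sqrt2$, if $a\cdot b=1\bmod 2$; if $a\cdot b=0\bmod 2$ (when the answer is ignored) reply $+1$. Let $\omega^*_{encode}$ be the success probability of an honest strategy in the encoding tests. *Marginal observables.* For prover $i$, let $\{N^{\alpha\beta}_{ab}\}$ and $\{M^{\alpha\beta}_{ab}\}$ be its POVMs for $(X,a,b)$ and $(Z,a,b)$, with $\alpha$ the answer to $a$ and $\beta$ the answer to $b$, and set $$\hat X(a)=\frac1{2^n}\sum_{b}\sum_{\beta}\big(N^{1\beta}_{ab}-N^{-1\,\beta}_{ab}\big),\qquad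 \hat Z(b)=\frac1{2^n}\sum_{a}\sum_{\alpha}\big(M^{\alpha 1}_{ab}-M^{\alpha\,-1}_{ab}\big).$$ **Lemma (quantum linearity test).** For every $r$ there is a constant $K>0$, depending only on $r$, such that the following holds for every such code that admits an honest strategy, every choice of $S^1,\dots,S^r$, every $n$ and every $\varepsilon\ge0$. Let $(N,|\psi\rangle)$ be a strategy that succeeds in the encoding tests with probability at least $\omega^*_{encode}-\varepsilon$. Then for every prover $i\in\{1,\dots,r\}$ there are an integer $m\ge 0$ and observables (Hermitian operators with square $\mathrm{Id}$) $X_{lin}(a)$, $Z_{lin}(a)$, $a\in\{0,1\}^n$, on $\mathcal H_i\otimes(\mathbb C^2)^{\otimes m}$ (prover $i$'s register extended by $m$ ancilla qubits) such that for all $a,b\in\{0,1\}^n$ $$X_{lin}(a)X_{lin}(b)=X_{lin}(a+b),\qquad Z_{lin}(a)Z_{lin}(b)=Z_{lin}(a+b),$$ and, with $|\psi'\rangle=|\psi\rangle\otimes|0^m\rangle$ and with $\hat X(a),\hat Z(b)$ acting as the identity on the ancillas, $$\frac1{2^{2n}}\sum_{a,b}\big\|\big(X_{lin}(a)Z_{lin}(b)-(-1)^{a\cdot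 b}Z_{lin}(b)X_{lin}(a)\big)|\psi'\rangle\big\|^2\le K\varepsilon^{1/4},$$ $$\frac1{2^n}\sum_a\big\|\big(X_{lin}(a)-\hat X(a)\big)|\psi'\rangle\big\|^2\le K\varepsilon^{1/4},\qquad \frac1{2^n}\sum_b\big\|\big(Z_{lin}(b)-\hat Z(b)\big)|\psi'\rangle\big\|^2\le K\varepsilon^{1/4}.$$ -/

import Mathlib

open scoped BigOperators Matrix Kronecker ComplexOrder

/-- `n`-bit strings, with addition modulo `2`. -/
abbrev Str (n : ℕ) : Type := Fin n → ZMod 2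

/-- The two basis settings. For a rotated query, `X` and `Z` stand for `X'` and `Z'`. -/
inductive PBasis
  | X
  | Z
  deriving DecidableEq

instance : Fintype PBasis where
  elems := {PBasis.X, PBasis.Z}
  complete := by intro N; cases N <;> decide

/-- Tensor product of a finite family of operators, the `j`-th acting on the register whose
computational basis is indexed by `ι j`. -/
def tensorOp {κ : Type*} [Fintype κ] {ι : κ → Type*}
    (A : ∀ j, Matrix (ι j) (ι j) ℂ) : Matrix (∀ j, ι j) (∀ j, ι j) ℂ :=
  Matrix.of fun x y => ∏ j, A j (x j) (y j)

/-- An observable: a Hermitian operator that squares to the identity. -/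
def IsObservable {ι : Type*} [Fintype ι] [DecidableEq ι] (A : Matrix ι ι ℂ) : Prop :=
  A.IsHermitian ∧ A * A = 1

/-- A POVM with outcomes in a finite set. -/
def IsPOVM {ι α : Type*} [Fintype ι] [DecidableEq ι] [Fintype α]
    (M : α → Matrix ι ι ℂ) : Prop :=
  (∀ x, (M x).PosSemidef) ∧ ∑ x, M x = 1

/-- The image `A |v⟩` of a vector under a matrix. -/
noncomputable def opApply {ι : Type*} [Fintype ι] [DecidableEq ι]
    (A : Matrix ι ι ℂ) (v : EuclideanSpace ℂ ι) : EuclideanSpace ℂ ι :=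
  Matrix.toEuclideanLin A v

/-! ### Queries, strategies and the Born rule -/

/-- Queries of the encoding tests: `pauli N (a, b)` is the `X`- or `Z`-query `(N, a, b)`,
answered by two signs; `rot N a b` is the `W`-query `(X', a, b)` or `(Z', a, b)`, answered by one
sign. -/
inductive Query (n : ℕ)
  | pauli (N : PBasis) (p : Str n × Str n)
  | rot (N : PBasis) (a b : Str n)

/-- Lexicographic order on strings. -/
def lexLE {n : ℕ} (a b : Str n) : Prop :=
  toLex (fun k => (a k).val) ≤ toLex (fun k => (b k).val)

open Classical in
/-- The pair `{a, b}` in lexicographic order, as it is sent to a prover. -/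
noncomputable def sortPair {n : ℕ} (a b : Str n) : Str n × Str n :=
  if lexLE a b then (a, b) else (b, a)

open Classical in
/-- Reads a reply to `sortPair a b` as the pair (answer to `a`, answer to `b`). -/
noncomputable def label {n : ℕ} (a b : Str n) (s : ℤˣ × ℤˣ) : ℤˣ × ℤˣ :=
  if lexLE a b then s else (s.2, s.1)

/-- A strategy for `r` provers: a shared pure state and, for each prover and each query, a POVM on
that prover's register. The one-sign answer `α` to a `W`-query is recorded as `(α, 1)`. -/
structure Strategy (r n : ℕ) (ι : Fin r → Type*)
    [∀ j, Fintype (ι j)] [∀ j, DecidableEq (ι j)] where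
  state : EuclideanSpace ℂ (∀ j, ι j)
  norm_state : ‖state‖ = 1
  meas : ∀ j, Query n → ℤˣ × ℤˣ → Matrix (ι j) (ι j) ℂ
  isPOVM : ∀ j q, IsPOVM (meas j q)
  rot_single : ∀ j N a b α, meas j (Query.rot N a b) (α, -1) = 0

section Game

variable {r n : ℕ} {ι : Fin r → Type*} [∀ j, Fintype (ι j)] [∀ j, DecidableEq (ι j)]

/-- Probability that the provers reply `ans` when prover `j` is sent the query `q j`. -/
noncomputable def Strategy.prob (P : Strategy r n ι) (q : Fin r → Query n)
    (ans : Fin r → ℤˣ × ℤˣ) : ℝ :=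
  (inner ℂ P.state (opApply (tensorOp fun j => P.meas j (q j) (ans j)) P.state)).re

open Classical in
/-- Probability that the replies to the queries `q` satisfy the acceptance predicate `acc`. -/
noncomputable def Strategy.acceptProb (P : Strategy r n ι) (q : Fin r → Query n)
    (acc : (Fin r → ℤˣ × ℤˣ) → Prop) : ℝ :=
  ∑ ans, if acc ans then P.prob q ans else 0

/-- The queries sent to the physical provers when `i` is the special prover, receiving `Q`, and the
composite prover receives the query complementary to `(N, u, c)`. Here `s` is the support of the
stabilizer used: the provers `j ≠ i` with `s j = 1` are sent `(N, u, c)`, and the remaining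
ones are sent unrelated strings `d j`. -/
noncomputable def roundQuery (s : Fin r → ZMod 2) (i : Fin r) (Q : Query n) (N : PBasis)
    (u c : Str n) (d : Fin r → Str n × Str n) (j : Fin r) : Query n :=
  if j = i then Q
  else if s j = 1 then Query.pauli N (sortPair u c)
  else Query.pauli N (sortPair (d j).1 (d j).2)

/-- The composite prover's answer to the string `u` of the complementary query to `(N, u, c)`:
the product of the answers of the provers that were not sent unrelated strings. -/
noncomputable def compositeAnswer (s : Fin r → ZMod 2) (i : Fin r) (u c : Str n)
    (ans : Fin r → ℤˣ × ℤˣ) : ℤˣ :=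
  ∏ j, if j ≠ i ∧ s j = 1 then (label u c (ans j)).1 else 1

/-- Acceptance probability in the linearity test with special prover `i`. The composite prover is
asked for `a`, `b` or `a + b`, according to `t`. -/
noncomputable def Strategy.linearityProb (P : Strategy r n ι) (s : Fin r → ZMod 2) (i : Fin r) :
    ℝ :=
  𝔼 N : PBasis, 𝔼 a : Str n, 𝔼 b : Str n, 𝔼 c : Str n, 𝔼 d : Fin r → Str n × Str n, 𝔼 t : Fin 3,
    P.acceptProb
      (roundQuery s i (Query.pauli N (sortPair a b)) N (![a, b, a + b] t) c d)
      (fun ans => compositeAnswer s i (![a, b, a + b] t) c ans =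
        ![(label a b (ans i)).1, (label a b (ans i)).2,
          (label a b (ans i)).1 * (label a b (ans i)).2] t)

/-- Acceptance probability in the anticommutation test with special prover `i`. -/
noncomputable def Strategy.anticommutationProb (P : Strategy r n ι) (s : Fin r → ZMod 2)
    (i : Fin r) : ℝ :=
  𝔼 N : PBasis, 𝔼 N' : PBasis, 𝔼 a : Str n, 𝔼 b : Str n, 𝔼 c : Str n,
    𝔼 d : Fin r → Str n × Str n,
    P.acceptProb
      (roundQuery s i (Query.rot N' a b) N (if N = PBasis.X then a else b) c d)
      (fun ans => a ⬝ᵥ b = 0 ∨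
        (ans i).1 * compositeAnswer s i (if N = PBasis.X then a else b) c ans =
          if N' = PBasis.Z ∧ N = PBasis.Z then -1 else 1)

/-- Acceptance probability in the stabilizer test with special prover `i`. -/
noncomputable def Strategy.stabilizerProb (P : Strategy r n ι) (s : Fin r → ZMod 2) (i : Fin r) :
    ℝ :=
  𝔼 N : PBasis, 𝔼 a : Str n, 𝔼 b : Str n, 𝔼 c : Str n, 𝔼 d : Fin r → Str n × Str n,
    P.acceptProb (roundQuery s i (Query.pauli N (sortPair a b)) N a c d)
      (fun ans => (label a b (ans i)).1 * compositeAnswer s i a c ans = 1)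

/-- Success probability in the encoding tests: the special prover `i` is uniformly random, and each
of the three tests is performed with probability `1/3`. `S i` is the support of the stabilizer
used when `i` is the special prover. -/
noncomputable def Strategy.encodeProb (P : Strategy r n ι) (S : Fin r → Fin r → ZMod 2) : ℝ :=
  𝔼 i : Fin r, (P.linearityProb (S i) i + P.anticommutationProb (S i) i
    + P.stabilizerProb (S i) i) / 3

/-- The operator `N_{ab}^{αβ}` of prover `j` for answer `α` to `a` and `β` to `b` on the query
`(N, a, b)`, the strings being sent in lexicographic order. -/
noncomputable def Strategy.pauliOp (P : Strategy r n ι) (j : Fin r) (N : PBasis) (a b : Str n)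
    (α β : ℤˣ) : Matrix (ι j) (ι j) ℂ :=
  P.meas j (Query.pauli N (sortPair a b)) (label a b (α, β))

/-- The marginal observable `X̂(a)` of prover `j`. -/
noncomputable def Strategy.hatX (P : Strategy r n ι) (j : Fin r) (a : Str n) :
    Matrix (ι j) (ι j) ℂ :=
  ((1 : ℂ) / 2 ^ n) • ∑ b : Str n, ∑ β : ℤˣ,
    (P.pauliOp j PBasis.X a b 1 β - P.pauliOp j PBasis.X a b (-1) β)

/-- The marginal observable `Ẑ(b)` of prover `j`. -/
noncomputable def Strategy.hatZ (P : Strategy r n ι) (j : Fin r) (b : Str n) :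
    Matrix (ι j) (ι j) ℂ :=
  ((1 : ℂ) / 2 ^ n) • ∑ a : Str n, ∑ α : ℤˣ,
    (P.pauliOp j PBasis.Z a b α 1 - P.pauliOp j PBasis.Z a b α (-1))

/-! ### Ancilla qubits -/

/-- Computational basis of `m` ancilla qubits. -/
abbrev Anc (m : ℕ) : Type := Fin m → Fin 2

/-- `|ψ⟩ ⊗ |0^m⟩`. -/
noncomputable def withAncilla (m : ℕ) (ψ : EuclideanSpace ℂ (∀ j, ι j)) :
    EuclideanSpace ℂ ((∀ j, ι j) × Anc m) :=
  WithLp.toLp 2 fun x => if x.2 = 0 then ψ x.1 else 0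

/-- An operator on prover `i`'s register extended by `m` ancilla qubits, acting as the identity on
the registers of the other provers. -/
def onProver (i : Fin r) (m : ℕ) (A : Matrix (ι i × Anc m) (ι i × Anc m) ℂ) :
    Matrix ((∀ j, ι j) × Anc m) ((∀ j, ι j) × Anc m) ℂ :=
  Matrix.of fun x y => A (x.1 i, x.2) (y.1 i, y.2) *
    ∏ j ∈ Finset.univ.erase i, (1 : Matrix (ι j) (ι j) ℂ) (x.1 j) (y.1 j)

/-- `‖A (|ψ⟩ ⊗ |0^m⟩)‖²` for an operator `A` on prover `i`'s extended register. -/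
noncomputable def Strategy.sqNorm (P : Strategy r n ι) (i : Fin r) (m : ℕ)
    (A : Matrix (ι i × Anc m) (ι i × Anc m) ℂ) : ℝ :=
  ‖opApply (onProver i m A) (withAncilla m P.state)‖ ^ 2

end Game

/-! ### Codes and the honest strategy -/

/-- A CSS code on `r` qubits, given by the supports of its stabilizers of `X` type and of `Z` type;
`orth` says that the stabilizers commute. -/
structure CSSCode (r : ℕ) where
  xStab : Submodule (ZMod 2) (Fin r → ZMod 2)
  zStab : Submodule (ZMod 2) (Fin r → ZMod 2)
  orth : ∀ s ∈ xStab, ∀ t ∈ zStab, s ⬝ᵥ t = 0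

/-- `S i` is the support both of an `X`-type and of a `Z`-type stabilizer, and contains `i`. -/
def CSSCode.IsChoice {r : ℕ} (C : CSSCode r) (S : Fin r → Fin r → ZMod 2) : Prop :=
  ∀ i, S i ∈ C.xStab ∧ S i ∈ C.zStab ∧ S i i = 1

/-- The single-qubit Pauli matrices `X` and `Z`. -/
def pauliMat : PBasis → Matrix (Fin 2) (Fin 2) ℂ
  | PBasis.X => !![0, 1; 1, 0]
  | PBasis.Z => !![1, 0; 0, -1]

/-- The `n`-qubit operators `X(a)` and `Z(a)`. -/
def pauliString {n : ℕ} (N : PBasis) (a : Str n) :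
    Matrix (Fin n → Fin 2) (Fin n → Fin 2) ℂ :=
  tensorOp fun k => if a k = 1 then pauliMat N else 1

/-- `φ` is a unit vector on `r` registers of `n` qubits such that for every `k` the `k`-th qubits of
the `r` registers are in the code space. -/
def CSSCode.IsEncoded {r : ℕ} (C : CSSCode r) {n : ℕ}
    (φ : EuclideanSpace ℂ (Fin r → Fin n → Fin 2)) : Prop :=
  ‖φ‖ = 1 ∧ ∀ k : Fin n,
    (∀ s ∈ C.xStab,
      opApply (tensorOp fun j => pauliString PBasis.X (Pi.single k (s j) : Str n)) φ = φ) ∧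
    (∀ s ∈ C.zStab,
      opApply (tensorOp fun j => pauliString PBasis.Z (Pi.single k (s j) : Str n)) φ = φ)

/-- The projection `(1 + α O) / 2` onto the `α`-eigenspace of an observable `O`. -/
noncomputable def eigProj {ι : Type*} [DecidableEq ι] (α : ℤˣ) (O : Matrix ι ι ℂ) :
    Matrix ι ι ℂ :=
  ((1 : ℂ) / 2) • (1 + ((α : ℤ) : ℂ) • O)

/-- `(X(a) + Z(b)) / √2` for the setting `X'` and `(X(a) - Z(b)) / √2` for `Z'`. -/
noncomputable def rotObs {n : ℕ} (N : PBasis) (a b : Str n) :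
    Matrix (Fin n → Fin 2) (Fin n → Fin 2) ℂ :=
  ((1 : ℂ) / (Real.sqrt 2 : ℝ)) •
    (pauliString PBasis.X a + (if N = PBasis.X then (1 : ℂ) else -1) • pauliString PBasis.Z b)

/-- The honest measurements. The operator `rotObs N a b` is an observable only if `a ⬝ᵥ b = 1`;
otherwise the answer to a `W`-query is irrelevant, and the honest prover replies `1`. -/
noncomputable def honestMeas {n : ℕ} :
    Query n → ℤˣ × ℤˣ → Matrix (Fin n → Fin 2) (Fin n → Fin 2) ℂ
  | Query.pauli N p, s => eigProj s.1 (pauliString N p.1) * eigProj s.2 (pauliString N p.2)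
  | Query.rot N a b, s =>
      if s.2 = 1 then
        if a ⬝ᵥ b = 1 then eigProj s.1 (rotObs N a b)
        else if s.1 = 1 then 1 else 0
      else 0

/-! ### The honest measurements are POVMs -/

theorem tensorOp_mul {κ : Type*} [Fintype κ] [DecidableEq κ] {ι : κ → Type*}
    [∀ j, Fintype (ι j)] (A B : ∀ j, Matrix (ι j) (ι j) ℂ) :
    tensorOp A * tensorOp B = tensorOp fun j => A j * B j := by
  ext x y
  simp only [tensorOp, Matrix.mul_apply, Matrix.of_apply, ← Finset.prod_mul_distrib]
  exact (Fintype.prod_sum fun j z => A j (x j) z * B j z (y j)).symm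

theorem tensorOp_one {κ : Type*} [Fintype κ] [DecidableEq κ] {ι : κ → Type*}
    [∀ j, DecidableEq (ι j)] :
    tensorOp (fun j => (1 : Matrix (ι j) (ι j) ℂ)) = 1 := by
  ext x y
  by_cases h : x = y
  · subst h; simp [tensorOp]
  · obtain ⟨j, hj⟩ := Function.ne_iff.mp h
    rw [Matrix.one_apply_ne h]
    exact Finset.prod_eq_zero (Finset.mem_univ j) (Matrix.one_apply_ne hj)

theorem tensorOp_conjTranspose {κ : Type*} [Fintype κ] {ι : κ → Type*}
    (A : ∀ j, Matrix (ι j) (ι j) ℂ) : (tensorOp A)ᴴ = tensorOp fun j => (A j)ᴴ := by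
  ext x y
  simp [tensorOp, Matrix.conjTranspose_apply]

theorem tensorOp_smul {κ : Type*} [Fintype κ] {ι : κ → Type*} (c : κ → ℂ)
    (A : ∀ j, Matrix (ι j) (ι j) ℂ) :
    tensorOp (fun j => c j • A j) = (∏ j, c j) • tensorOp A := by
  ext x y
  simp [tensorOp, Finset.prod_mul_distrib]

theorem pauliMat_isHermitian (N : PBasis) : (pauliMat N).IsHermitian := by
  ext x y
  cases N <;> fin_cases x <;> fin_cases y <;> simp [pauliMat]

theorem pauliMat_mul_self (N : PBasis) : pauliMat N * pauliMat N = 1 := by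
  ext x y
  cases N <;> fin_cases x <;> fin_cases y <;> simp [pauliMat]

theorem pauliMat_anticomm :
    pauliMat PBasis.X * pauliMat PBasis.Z = (-1 : ℂ) • (pauliMat PBasis.Z * pauliMat PBasis.X) := by
  ext x y
  fin_cases x <;> fin_cases y <;> simp [pauliMat]

theorem pauliString_isObservable {n : ℕ} (N : PBasis) (a : Str n) :
    IsObservable (pauliString N a) := by
  constructor
  · unfold Matrix.IsHermitian pauliString
    rw [tensorOp_conjTranspose]
    congr 1; funext k
    split_ifs
    · exact pauliMat_isHermitian N
    · simp
  · unfold pauliString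
    rw [tensorOp_mul, ← tensorOp_one]
    congr 1; funext k
    split_ifs
    · exact pauliMat_mul_self N
    · simp

theorem pauliString_comm {n : ℕ} (N : PBasis) (a b : Str n) :
    Commute (pauliString N a) (pauliString N b) := by
  unfold Commute SemiconjBy pauliString
  rw [tensorOp_mul, tensorOp_mul]
  congr 1; funext k
  split_ifs <;> simp

theorem pauliString_anticomm {n : ℕ} (a b : Str n) (h : a ⬝ᵥ b = 1) :
    pauliString PBasis.X a * pauliString PBasis.Z b =
      -(pauliString PBasis.Z b * pauliString PBasis.X a) := by
  have hz : ∀ z : ZMod 2, z = 0 ∨ z = 1 := by decide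
  have key : ∀ t : Finset (Fin n),
      (∏ k ∈ t, if a k = 1 ∧ b k = 1 then (-1 : ℂ) else 1) =
        (if (∑ k ∈ t, a k * b k) = 1 then (-1 : ℂ) else 1) := by
    intro t
    induction t using Finset.induction_on with
    | empty => simp
    | insert k t hk ih =>
      rw [Finset.prod_insert hk, Finset.sum_insert hk, ih]
      rcases hz (∑ k ∈ t, a k * b k) with h2 | h2 <;>
      rcases hz (a k) with h3 | h3 <;> rcases hz (b k) with h4 | h4 <;>
        simp [h2, h3, h4, CharTwo.add_self_eq_zero]
  have hu := key Finset.univ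
  have hd : (∑ k, a k * b k) = 1 := h
  rw [if_pos hd] at hu
  have e : pauliString PBasis.X a * pauliString PBasis.Z b =
      (∏ k, if a k = 1 ∧ b k = 1 then (-1 : ℂ) else 1) •
        (pauliString PBasis.Z b * pauliString PBasis.X a) := by
    unfold pauliString
    rw [tensorOp_mul, tensorOp_mul, ← tensorOp_smul]
    congr 1; funext k
    by_cases h1 : a k = 1 <;> by_cases h2 : b k = 1 <;> simp [h1, h2, pauliMat_anticomm]
  rw [e, hu, neg_one_smul]

theorem rotObs_isObservable {n : ℕ} (N : PBasis) (a b : Str n) (h : a ⬝ᵥ b = 1) :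
    IsObservable (rotObs N a b) := by
  obtain ⟨hx, hx2⟩ := pauliString_isObservable PBasis.X a
  obtain ⟨hz, hz2⟩ := pauliString_isObservable PBasis.Z b
  have hs : ((Real.sqrt 2 : ℝ) : ℂ) * ((Real.sqrt 2 : ℝ) : ℂ) = 2 := by
    rw [← Complex.ofReal_mul, Real.mul_self_sqrt (by norm_num)]; norm_num
  have hs0 : ((1 : ℂ) / (Real.sqrt 2 : ℝ)) * ((1 : ℂ) / (Real.sqrt 2 : ℝ)) = 1 / 2 := by
    rw [div_mul_div_comm, hs, one_mul]
  have hac := pauliString_anticomm a b h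
  constructor
  · unfold Matrix.IsHermitian rotObs
    rw [Matrix.conjTranspose_smul, Matrix.conjTranspose_add, Matrix.conjTranspose_smul, hx, hz]
    congr 1
    · simp
    · congr 2; split_ifs <;> simp
  · unfold rotObs
    rw [smul_mul_smul_comm, hs0]
    cases N
    · simp only [if_true, one_smul, mul_add, add_mul, hx2, hz2, hac]
      rw [show (1 : Matrix (Fin n → Fin 2) (Fin n → Fin 2) ℂ)
        + pauliString PBasis.Z b * pauliString PBasis.X a
        + (-(pauliString PBasis.Z b * pauliString PBasis.X a) + 1) = (2 : ℂ) • 1 by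
          rw [two_smul]; abel]
      rw [smul_smul]; norm_num
    · simp only [reduceCtorEq, if_false, neg_one_smul, mul_add, add_mul, hx2, hz2, hac,
        mul_neg, neg_mul, neg_add_rev, neg_neg]
      rw [show (1 : Matrix (Fin n → Fin 2) (Fin n → Fin 2) ℂ)
        + -(pauliString PBasis.Z b * pauliString PBasis.X a)
        + (1 + pauliString PBasis.Z b * pauliString PBasis.X a) = (2 : ℂ) • 1 by
          rw [two_smul]; abel]
      rw [smul_smul]; norm_num

theorem eigProj_isHermitian {ι : Type*} [Fintype ι] [DecidableEq ι] (α : ℤˣ) (O : Matrix ι ι ℂ)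
    (h : IsObservable O) : (eigProj α O).IsHermitian := by
  unfold Matrix.IsHermitian eigProj
  rw [Matrix.conjTranspose_smul, Matrix.conjTranspose_add, Matrix.conjTranspose_smul, h.1]
  simp

theorem eigProj_mul_self {ι : Type*} [Fintype ι] [DecidableEq ι] (α : ℤˣ) (O : Matrix ι ι ℂ)
    (h : IsObservable O) : eigProj α O * eigProj α O = eigProj α O := by
  unfold eigProj
  rw [smul_mul_smul_comm]
  have h2 := h.2
  rcases Int.units_eq_one_or α with rfl | rfl
  · simp only [Units.val_one, Int.cast_one, one_smul, mul_add, add_mul, one_mul, mul_one, h2]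
    rw [show (1 : Matrix ι ι ℂ) + O + (O + 1) = (2 : ℂ) • (1 + O) by rw [two_smul]; abel, smul_smul]
    norm_num
  · simp only [Units.val_neg, Units.val_one, Int.cast_neg, Int.cast_one, neg_one_smul, mul_add,
      add_mul, one_mul, mul_one, neg_mul, mul_neg, neg_add_rev, neg_neg, h2]
    rw [show (1 : Matrix ι ι ℂ) + -O + (1 + -O) = (2 : ℂ) • (1 + -O) by rw [two_smul],
      smul_smul]
    norm_num

theorem eigProj_commute {ι : Type*} [Fintype ι] [DecidableEq ι] (α β : ℤˣ) (O Q : Matrix ι ι ℂ)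
    (h : Commute O Q) : Commute (eigProj α O) (eigProj β Q) := by
  unfold eigProj
  refine Commute.smul_left (Commute.smul_right ?_ _) _
  refine Commute.add_left (Commute.one_left _) (Commute.add_right (Commute.one_right _) ?_)
  exact Commute.smul_left (Commute.smul_right h _) _

theorem eigProj_sum {ι : Type*} [DecidableEq ι] (O : Matrix ι ι ℂ) :
    eigProj 1 O + eigProj (-1) O = 1 := by
  unfold eigProj
  rw [← smul_add]
  simp only [Units.val_one, Int.cast_one, one_smul, Units.val_neg, Int.cast_neg, neg_one_smul]
  rw [show (1 : Matrix ι ι ℂ) + O + (1 + -O) = (2 : ℂ) • 1 by rw [two_smul]; abel, smul_smul]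
  norm_num

theorem posSemidef_of_proj {ι : Type*} [Fintype ι] [DecidableEq ι] (A : Matrix ι ι ℂ)
    (h : A.IsHermitian) (h2 : A * A = A) : A.PosSemidef := by
  have := Matrix.posSemidef_conjTranspose_mul_self A
  rwa [h, h2] at this

theorem sum_units_int {M : Type*} [AddCommMonoid M] (f : ℤˣ → M) :
    ∑ α, f α = f 1 + f (-1) := by
  rw [show (Finset.univ : Finset ℤˣ) = {1, -1} by decide, Finset.sum_pair (by decide)]

theorem honestMeas_isPOVM {n : ℕ} (q : Query n) : IsPOVM (honestMeas q) := by
  cases q with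
  | pauli N p =>
    have hc := fun α β : ℤˣ => eigProj_commute α β _ _ (pauliString_comm N p.1 p.2)
    have ha := pauliString_isObservable N p.1
    have hb := pauliString_isObservable N p.2
    constructor
    · rintro ⟨α, β⟩
      refine posSemidef_of_proj _ ?_ ?_
      · simp only [honestMeas]
        unfold Matrix.IsHermitian
        rw [Matrix.conjTranspose_mul, eigProj_isHermitian _ _ ha, eigProj_isHermitian _ _ hb]
        exact (hc α β).symm
      · simp only [honestMeas]
        rw [mul_assoc, ← mul_assoc (eigProj β _), ← (hc α β).eq, mul_assoc (eigProj α _),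
          eigProj_mul_self _ _ hb, ← mul_assoc, eigProj_mul_self _ _ ha]
    · rw [Fintype.sum_prod_type]
      simp only [honestMeas, sum_units_int, ← mul_add, eigProj_sum, mul_one]
  | rot N a b =>
    constructor
    · rintro ⟨α, β⟩
      simp only [honestMeas]
      split_ifs with h1 h2 h3
      · exact posSemidef_of_proj _ (eigProj_isHermitian _ _ (rotObs_isObservable N a b h2))
          (eigProj_mul_self _ _ (rotObs_isObservable N a b h2))
      · exact Matrix.PosSemidef.one
      · exact Matrix.PosSemidef.zero
      · exact Matrix.PosSemidef.zero
    · rw [Fintype.sum_prod_type]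
      have hne : ¬ ((-1 : ℤˣ) = 1) := by decide
      by_cases h2 : a ⬝ᵥ b = 1
      · simp only [honestMeas, sum_units_int, if_true, if_neg hne, h2, add_zero, eigProj_sum]
      · simp only [honestMeas, sum_units_int, if_true, if_neg hne, if_neg h2, add_zero]

/-- The honest strategy with shared state `φ`: each prover holds `n` qubits. -/
noncomputable def honestStrategy {r n : ℕ} (φ : EuclideanSpace ℂ (Fin r → Fin n → Fin 2))
    (hφ : ‖φ‖ = 1) : Strategy r n (fun _ => Fin n → Fin 2) where
  state := φ
  norm_state := hφ
  meas := fun _ q => honestMeas q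
  isPOVM := fun _ q => honestMeas_isPOVM q
  rot_single := fun _ N a b α => by
    simp only [honestMeas]
    rw [if_neg (by decide)]

/-! Fix a special prover `i` and let `compositeObs` be the observable of the composite answer to a
string, averaged over the padding. It lives on the other registers, so it commutes exactly with
every operator on register `i`. Write `B_X(a)`, `B_Z(b)` for it; it is the pivot through which all
approximate relations pass.

The success probability of each test is affine in correlations between prover `i` and the composite
prover. The honest strategy is optimal in every test separately: it wins the linearity and
stabilizer tests with certainty, and for `a · b = 1` the anticommutation test is a CHSH game which
it plays at Tsirelson's bound `2√2`. Hence a loss of `ε` overall costs at most `3rε` in each test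
with each special prover (`tests_of_encodeProb`). The linearity test then shows that the marginals
agree with the composite observables on `ψ`, on average, and that both are approximately linear
there (`expect_norm_apply_apply_sub_sq_le`). Near-optimality in CHSH makes `B_X(a)` and `B_Z(b)`
nearly anticommute on `ψ` when `a · b = 1` (`tsirelson_rigidity`).

Exact linearity comes from the regular representation (`exists_linear_observables_aux`). The map `v
↦ 2^{-n/2} ∑_b |b⟩ ⊗ H(b) v`, completed to an isometry, compresses the translation by `a` to the
average of `H(b) H(a+b)` plus a small correction, and approximate linearity puts this close to
`H(a)` on `ψ`. Conjugating by a unitary replaces the isometry by the embedding `v ↦ v ⊗ |0^m⟩`. So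
`X_lin(a) ψ'` is close to `B_X(a) ψ ⊗ |0^m⟩` (`exists_rounding`), and likewise for `Z`.

Anticommutation for `a · b = 1` now passes from the composite observables to `X_lin`, `Z_lin`. The
case `a · b = 0` is not tested; it follows from linearity by writing `a = a' + a''` with `a' · b =
a'' · b = 1`, since two sign changes cancel (`expect_twisted_commutator_sq_le`).

The only loss of a power is one square root in the rounding, so small `ε` gives `O(√ε)`, which is at
most `O(ε^{1/4})`; for large `ε` trivial observables suffice. -/

/-! ### Symmetric contractions on an inner product space -/

section HilbertSpace

variable {E : Type*} [NormedAddCommGroup E] [InnerProductSpace ℂ E]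

/-- A symmetric operator of norm at most `1`. -/
structure IsSymmContraction (A : E →ₗ[ℂ] E) : Prop where
  symm : ∀ v w, inner ℂ (A v) w = inner ℂ v (A w)
  norm_le : ∀ v, ‖A v‖ ≤ ‖v‖

theorem norm_add_three_sq_le {E : Type*} [SeminormedAddCommGroup E] (x y z : E) :
    ‖x + y + z‖ ^ 2 ≤ 3 * (‖x‖ ^ 2 + ‖y‖ ^ 2 + ‖z‖ ^ 2) := by
  have h : ‖x + y + z‖ ≤ ‖x‖ + ‖y‖ + ‖z‖ := norm_add₃_le
  have h2 := pow_le_pow_left₀ (norm_nonneg _) h 2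
  nlinarith [sq_nonneg (‖x‖ - ‖y‖), sq_nonneg (‖x‖ - ‖z‖), sq_nonneg (‖y‖ - ‖z‖)]

theorem norm_add_four_sq_le {E : Type*} [SeminormedAddCommGroup E] (x y z w : E) :
    ‖x + y + z + w‖ ^ 2 ≤ 4 * (‖x‖ ^ 2 + ‖y‖ ^ 2 + ‖z‖ ^ 2 + ‖w‖ ^ 2) := by
  have h : ‖x + y + z + w‖ ≤ ‖x‖ + ‖y‖ + ‖z‖ + ‖w‖ := norm_add₄_le
  have h2 := pow_le_pow_left₀ (norm_nonneg _) h 2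
  nlinarith [sq_nonneg (‖x‖ - ‖y‖), sq_nonneg (‖x‖ - ‖z‖), sq_nonneg (‖x‖ - ‖w‖),
    sq_nonneg (‖y‖ - ‖z‖), sq_nonneg (‖y‖ - ‖w‖), sq_nonneg (‖z‖ - ‖w‖)]

theorem norm_sub_sq_le_of_norm_le_one {u v : E} (hu : ‖u‖ ≤ 1) (hv : ‖v‖ ≤ 1) :
    ‖u - v‖ ^ 2 ≤ 2 * (1 - (inner ℂ u v).re) := by
  have h := norm_sub_sq (𝕜 := ℂ) u v
  rw [RCLike.re_eq_complex_re] at h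
  have h1 := pow_le_one₀ (n := 2) (norm_nonneg _) hu
  have h2 := pow_le_one₀ (n := 2) (norm_nonneg _) hv
  linarith

theorem abs_re_inner_le_norm (u v : E) : |(inner ℂ u v).re| ≤ ‖u‖ * ‖v‖ :=
  (Complex.abs_re_le_norm _).trans (norm_inner_le_norm u v)

/-- Expand the square: by symmetry the cross term is `-2‖A v‖²`. This replaces `A² = 1`, which fails
for contractions: where `A` nearly preserves the norm, `A²` nearly fixes the vector. -/
theorem IsSymmContraction.norm_apply_apply_sub_sq_le {A : E →ₗ[ℂ] E} (hA : IsSymmContraction A)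
    (v : E) : ‖A (A v) - v‖ ^ 2 ≤ ‖v‖ ^ 2 - ‖A v‖ ^ 2 := by
  have h := norm_sub_sq (𝕜 := ℂ) (A (A v)) v
  rw [hA.symm, inner_self_eq_norm_sq] at h
  have h1 := pow_le_pow_left₀ (norm_nonneg _) (hA.norm_le (A v)) 2
  linarith

/-- The chain is `D D ψ ≈ D V ψ = V D ψ ≈ V V ψ ≈ ψ`. It is meant for `D = (A ± C)/√2`, whence the
norm bound `√2`. -/
theorem norm_sq_sub_le_of_approx {D V : E →ₗ[ℂ] E} {ψ : E} (hψ : ‖ψ‖ = 1)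
    (hV : IsSymmContraction V) (hc : ∀ v, V (D v) = D (V v)) (hD : ∀ v, ‖D v‖ ≤ √2 * ‖v‖) :
    ‖D (D ψ) - ψ‖ ^ 2 ≤ 9 * (‖D ψ - V ψ‖ ^ 2 + (1 - ‖V ψ‖ ^ 2)) := by
  have e : D (D ψ) - ψ = D (D ψ - V ψ) + V (D ψ - V ψ) + (V (V ψ) - ψ) := by
    rw [map_sub, map_sub, hc]; abel
  have t1 := norm_add_three_sq_le (D (D ψ - V ψ)) (V (D ψ - V ψ)) (V (V ψ) - ψ)
  have t2 := pow_le_pow_left₀ (norm_nonneg _) (hD (D ψ - V ψ)) 2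
  have t3 := pow_le_pow_left₀ (norm_nonneg _) (hV.norm_le (D ψ - V ψ)) 2
  have t4 := hV.norm_apply_apply_sub_sq_le ψ
  have t5 := pow_le_pow_left₀ (norm_nonneg _) (hV.norm_le ψ) 2
  rw [hψ] at t4 t5
  rw [mul_pow, Real.sq_sqrt (by norm_num)] at t2
  rw [e]
  linarith

/-- Quantitative rigidity in Tsirelson's bound: if `A ± C` are nearly optimally correlated with
symmetric contractions commuting with `A` and `C`, then `A` and `C` nearly anticommute. -/
theorem tsirelson_rigidity {A C V W : E →ₗ[ℂ] E} (hA : IsSymmContraction A)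
    (hC : IsSymmContraction C) (hV : IsSymmContraction V) (hW : IsSymmContraction W)
    (hVA : ∀ v, V (A v) = A (V v)) (hVC : ∀ v, V (C v) = C (V v))
    (hWA : ∀ v, W (A v) = A (W v)) (hWC : ∀ v, W (C v) = C (W v)) {ψ : E} (hψ : ‖ψ‖ = 1) :
    ‖A (C ψ) + C (A ψ)‖ ^ 2 ≤
      100 * (2 * √2 - ((inner ℂ (V ψ) (A ψ)).re + (inner ℂ (V ψ) (C ψ)).re
        + (inner ℂ (W ψ) (A ψ)).re - (inner ℂ (W ψ) (C ψ)).re)) := by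
  set g := 2 * √2 - ((inner ℂ (V ψ) (A ψ)).re + (inner ℂ (V ψ) (C ψ)).re
        + (inner ℂ (W ψ) (A ψ)).re - (inner ℂ (W ψ) (C ψ)).re) with hg
  set s : ℂ := ((√2 / 2 : ℝ) : ℂ) with hs
  have h2 : √2 * √2 = 2 := Real.mul_self_sqrt (by norm_num)
  have h2p : 0 < √2 := by positivity
  have h2u : √2 < 3 / 2 := by
    rw [Real.sqrt_lt' (by norm_num)]; norm_num
  have hss : s * s = 1 / 2 := by
    rw [hs, ← Complex.ofReal_mul]
    rw [show √2 / 2 * (√2 / 2) = 1 / 2 by linarith]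
    norm_num
  have hsn : ‖s‖ = √2 / 2 := by
    rw [hs, Complex.norm_real, Real.norm_of_nonneg (by positivity)]
  have nA := pow_le_pow_left₀ (norm_nonneg _) (hA.norm_le ψ) 2
  have nC := pow_le_pow_left₀ (norm_nonneg _) (hC.norm_le ψ) 2
  have nV := pow_le_pow_left₀ (norm_nonneg _) (hV.norm_le ψ) 2
  have nW := pow_le_pow_left₀ (norm_nonneg _) (hW.norm_le ψ) 2
  rw [hψ] at nA nC nV nW
  set u := s • (A ψ + C ψ) - V ψ with hu
  set w := s • (A ψ - C ψ) - W ψ with hw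
  -- Sum-of-squares form of Tsirelson's bound. The slack in the inequality is that of `‖A ψ‖, ‖C ψ‖
  -- ≤ 1`, which enters through the parallelogram law.
  have hsum : ‖u‖ ^ 2 + ‖w‖ ^ 2 + (1 - ‖V ψ‖ ^ 2) + (1 - ‖W ψ‖ ^ 2) ≤ √2 * g := by
    have e1 := norm_sub_sq (𝕜 := ℂ) (s • (A ψ + C ψ)) (V ψ)
    have e2 := norm_sub_sq (𝕜 := ℂ) (s • (A ψ - C ψ)) (W ψ)
    rw [norm_smul, inner_smul_left, inner_add_left, mul_pow, hsn] at e1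
    rw [norm_smul, inner_smul_left, inner_sub_left, mul_pow, hsn] at e2
    have e3 := parallelogram_law_with_norm ℂ (A ψ) (C ψ)
    rw [hs, Complex.conj_ofReal, RCLike.re_eq_complex_re, Complex.re_ofReal_mul,
      Complex.add_re] at e1
    rw [hs, Complex.conj_ofReal, RCLike.re_eq_complex_re, Complex.re_ofReal_mul,
      Complex.sub_re] at e2
    have c1 : ∀ x y : E, (inner ℂ x y).re = (inner ℂ y x).re := fun x y => by
      rw [← inner_conj_symm, Complex.conj_re]
    rw [c1 (A ψ), c1 (C ψ)] at e1 e2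
    have e4 : (√2 / 2) ^ 2 = 1 / 2 := by nlinarith
    rw [e4] at e1 e2
    have e5 : √2 * g = 4 - √2 * ((inner ℂ (V ψ) (A ψ)).re + (inner ℂ (V ψ) (C ψ)).re
        + (inner ℂ (W ψ) (A ψ)).re - (inner ℂ (W ψ) (C ψ)).re) := by
      rw [hg]; linear_combination 2 * h2
    rw [hu, hw, e1, e2, e5]
    nlinarith
  have f1 := norm_sq_sub_le_of_approx (D := s • (A + C)) hψ hV
    (fun v => by simp [hVA, hVC]) (fun v => by
    have := norm_add_le_of_le (hA.norm_le v) (hC.norm_le v)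
    simp only [LinearMap.smul_apply, LinearMap.add_apply, norm_smul, hsn]
    nlinarith [norm_nonneg v])
  have f2 := norm_sq_sub_le_of_approx (D := s • (A - C)) hψ hW
    (fun v => by simp [hWA, hWC]) (fun v => by
    have := norm_sub_le_of_le (hA.norm_le v) (hC.norm_le v)
    simp only [LinearMap.smul_apply, LinearMap.sub_apply, norm_smul, hsn]
    nlinarith [norm_nonneg v])
  -- The anticommutator is the difference of the squares of `(A + C)/√2` and `(A - C)/√2`, both of
  -- which nearly fix `ψ`.
  have e : A (C ψ) + C (A ψ) = ((s • (A + C)) ((s • (A + C)) ψ) - ψ)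
      - ((s • (A - C)) ((s • (A - C)) ψ) - ψ) := by
    simp only [LinearMap.smul_apply, LinearMap.sub_apply, LinearMap.add_apply, map_smul, map_add,
      map_sub, smul_add, smul_sub, smul_smul, hss]
    module
  have t := norm_sub_le ((s • (A + C)) ((s • (A + C)) ψ) - ψ)
    ((s • (A - C)) ((s • (A - C)) ψ) - ψ)
  rw [← e] at t
  have t2 := pow_le_pow_left₀ (norm_nonneg _) t 2
  have u1 : (s • (A + C)) ψ - V ψ = u := rfl
  have u2 : (s • (A - C)) ψ - W ψ = w := rfl
  rw [u1] at f1
  rw [u2] at f2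
  have gp : 0 ≤ g := by
    refine (mul_nonneg_iff_of_pos_left h2p).1 ?_
    linarith [sq_nonneg ‖u‖, sq_nonneg ‖w‖]
  have gm : √2 * g ≤ 3 / 2 * g := mul_le_mul_of_nonneg_right h2u.le gp
  linarith [add_sq_le (a := ‖(s • (A + C)) ((s • (A + C)) ψ) - ψ‖)
    (b := ‖(s • (A - C)) ((s • (A - C)) ψ) - ψ‖)]

/-! ### Approximate linearity -/

section Expect

variable {G : Type*} [Fintype G]

theorem expect_mono {f g : G → ℝ} (h : ∀ a, f a ≤ g a) : 𝔼 a, f a ≤ 𝔼 a, g a :=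
  Finset.expect_le_expect fun a _ => h a

theorem expect_nonneg_of_forall {f : G → ℝ} (h : ∀ a, 0 ≤ f a) : 0 ≤ 𝔼 a, f a :=
  Finset.expect_nonneg fun a _ => h a

theorem expect_le_sqrt_expect_sq [Nonempty G] (f : G → ℝ) : 𝔼 a, f a ≤ √(𝔼 a, f a ^ 2) := by
  refine Real.le_sqrt_of_sq_le ?_
  have := Finset.expect_mul_sq_le_sq_mul_sq Finset.univ f (fun _ => 1)
  simpa [Fintype.expect_const] using this

theorem expect_add_left [AddCommGroup G] (c : G) (f : G → ℝ) : 𝔼 a, f (c + a) = 𝔼 a, f a :=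
  Fintype.expect_equiv (Equiv.addLeft c) _ _ fun _ => rfl

theorem expect_add_right [AddCommGroup G] (c : G) (f : G → ℝ) : 𝔼 a, f (a + c) = 𝔼 a, f a :=
  Fintype.expect_equiv (Equiv.addRight c) _ _ fun _ => rfl

theorem expect_norm_sub_sq_le [Nonempty G] {u v : G → E} {η : ℝ} (hu : ∀ a, ‖u a‖ ≤ 1)
    (hv : ∀ a, ‖v a‖ ≤ 1) (h : 1 - η ≤ 𝔼 a, (inner ℂ (u a) (v a)).re) :
    𝔼 a, ‖u a - v a‖ ^ 2 ≤ 2 * η := by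
  refine (expect_mono fun a => norm_sub_sq_le_of_norm_le_one (hu a) (hv a)).trans ?_
  rw [← Finset.mul_expect, Finset.expect_sub_distrib, Fintype.expect_const]
  linarith

theorem expect_expect_norm_sub_sq_le [Nonempty G] {u v : G → G → E} {η : ℝ}
    (hu : ∀ a b, ‖u a b‖ ≤ 1) (hv : ∀ a b, ‖v a b‖ ≤ 1)
    (h : 1 - η ≤ 𝔼 a, 𝔼 b, (inner ℂ (u a b) (v a b)).re) :
    𝔼 a, 𝔼 b, ‖u a b - v a b‖ ^ 2 ≤ 2 * η := by
  refine (expect_mono fun a => expect_mono fun b =>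
    norm_sub_sq_le_of_norm_le_one (hu a b) (hv a b)).trans ?_
  simp only [← Finset.mul_expect, Finset.expect_sub_distrib, Fintype.expect_const]
  linarith

/-- If the operators `M₁ a b`, `M₂ a b` and `M₁₂ a b` (approximately the product of `M₁ a b` and
`M₂ a b`) are on average well correlated with `B a`, `B b` and `B (a + b)`, and the operators `H a`
with `B a`, then `H` is approximately linear. -/
theorem expect_norm_apply_apply_sub_sq_le [AddCommGroup G] {B H : G → E →ₗ[ℂ] E} {M₁ M₂ M₁₂ : G → G → E →ₗ[ℂ] E}
    {ψ : E} {η : ℝ} (hψ : ‖ψ‖ = 1) (hB : ∀ a, IsSymmContraction (B a))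
    (hH : ∀ a, IsSymmContraction (H a)) (hM₁ : ∀ a b, IsSymmContraction (M₁ a b))
    (hM₂ : ∀ a b, IsSymmContraction (M₂ a b)) (hM₁₂ : ∀ a b, IsSymmContraction (M₁₂ a b))
    (hMM : ∀ a b, ‖M₁₂ a b ψ - M₁ a b (M₂ a b ψ)‖ ^ 2 ≤ 1 - ‖M₂ a b ψ‖ ^ 2)
    (hcH : ∀ a b v, H a (B b v) = B b (H a v))
    (hcM : ∀ a b c v, M₁ a b (B c v) = B c (M₁ a b v))
    (h₁ : 1 - η ≤ 𝔼 a, 𝔼 b, (inner ℂ (M₁ a b ψ) (B a ψ)).re)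
    (h₂ : 1 - η ≤ 𝔼 a, 𝔼 b, (inner ℂ (M₂ a b ψ) (B b ψ)).re)
    (h₁₂ : 1 - η ≤ 𝔼 a, 𝔼 b, (inner ℂ (M₁₂ a b ψ) (B (a + b) ψ)).re)
    (h : 1 - η ≤ 𝔼 a, (inner ℂ (H a ψ) (B a ψ)).re) :
    𝔼 a, 𝔼 b, ‖H b (H a ψ) - H (a + b) ψ‖ ^ 2 ≤ 152 * η := by
  have le1 : ∀ {A : E →ₗ[ℂ] E}, IsSymmContraction A → ‖A ψ‖ ≤ 1 := fun hA =>
    hψ ▸ hA.norm_le ψ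
  have k₁ := expect_expect_norm_sub_sq_le (fun a b => le1 (hM₁ a b)) (fun a b => le1 (hB a)) h₁
  have k₂ := expect_expect_norm_sub_sq_le (fun a b => le1 (hM₂ a b)) (fun a b => le1 (hB b)) h₂
  have k₁₂ := expect_expect_norm_sub_sq_le (fun a b => le1 (hM₁₂ a b))
    (fun a b => le1 (hB (a + b))) h₁₂
  have k := expect_norm_sub_sq_le (fun a => le1 (hH a)) (fun a => le1 (hB a)) h
  -- With `x = ‖M₂ ψ‖ ≤ 1`, `1 - x² ≤ 2(1 - x)`, and the correlation with `B b` is at most `x`.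
  have kM : 𝔼 a, 𝔼 b, ‖M₁₂ a b ψ - M₁ a b (M₂ a b ψ)‖ ^ 2 ≤ 2 * η := by
    have : ∀ a b, ‖M₁₂ a b ψ - M₁ a b (M₂ a b ψ)‖ ^ 2 ≤
        2 * (1 - (inner ℂ (M₂ a b ψ) (B b ψ)).re) := by
      intro a b
      refine (hMM a b).trans ?_
      have e1 := (abs_le.1 (abs_re_inner_le_norm (M₂ a b ψ) (B b ψ))).2
      have e2 := le1 (hB b)
      nlinarith [norm_nonneg (M₂ a b ψ), sq_nonneg (1 - ‖M₂ a b ψ‖), norm_nonneg (B b ψ)]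
    refine (expect_mono fun a => expect_mono fun b => this a b).trans ?_
    simp only [← Finset.mul_expect, Finset.expect_sub_distrib, Fintype.expect_const]
    linarith
  have sq : ∀ {A : E →ₗ[ℂ] E}, IsSymmContraction A → ∀ v, ‖A v‖ ^ 2 ≤ ‖v‖ ^ 2 :=
    fun hA v => pow_le_pow_left₀ (norm_nonneg _) (hA.norm_le v) 2
  -- `B (a + b) ψ ≈ M₁₂ ψ ≈ M₁ M₂ ψ ≈ M₁ (B b) ψ = B b M₁ ψ ≈ B b (B a) ψ`.
  have p1 : ∀ a b, ‖B b (B a ψ) - B (a + b) ψ‖ ^ 2 ≤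
      4 * (‖M₁₂ a b ψ - B (a + b) ψ‖ ^ 2 + ‖M₁₂ a b ψ - M₁ a b (M₂ a b ψ)‖ ^ 2
        + ‖M₂ a b ψ - B b ψ‖ ^ 2 + ‖M₁ a b ψ - B a ψ‖ ^ 2) := by
    intro a b
    have e : -(B b (B a ψ) - B (a + b) ψ) = -(M₁₂ a b ψ - B (a + b) ψ)
        + (M₁₂ a b ψ - M₁ a b (M₂ a b ψ)) + M₁ a b (M₂ a b ψ - B b ψ)
        + B b (M₁ a b ψ - B a ψ) := by
      rw [map_sub, map_sub, hcM]; abel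
    rw [← norm_neg, e]
    refine (norm_add_four_sq_le _ _ _ _).trans ?_
    rw [norm_neg]
    linarith [sq (hM₁ a b) (M₂ a b ψ - B b ψ), sq (hB b) (M₁ a b ψ - B a ψ)]
  have q1 : 𝔼 a, 𝔼 b, ‖B b (B a ψ) - B (a + b) ψ‖ ^ 2 ≤ 32 * η := by
    refine (expect_mono fun a => expect_mono fun b => p1 a b).trans ?_
    simp only [← Finset.mul_expect, Finset.expect_add_distrib]
    linarith
  -- `H b (H a) ψ ≈ H b (B a) ψ = B a (H b) ψ ≈ B a (B b) ψ ≈ B (b + a) ψ ≈ H (a + b) ψ`. On average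
  -- the four errors are `2η`, `2η`, `32η` and `2η`, whence `152 = 4 · 38`.
  have p2 : ∀ a b, ‖H b (H a ψ) - H (a + b) ψ‖ ^ 2 ≤
      4 * (‖H a ψ - B a ψ‖ ^ 2 + ‖H b ψ - B b ψ‖ ^ 2 + ‖B a (B b ψ) - B (b + a) ψ‖ ^ 2
        + ‖H (a + b) ψ - B (a + b) ψ‖ ^ 2) := by
    intro a b
    have e : H b (H a ψ) - H (a + b) ψ = H b (H a ψ - B a ψ) + B a (H b ψ - B b ψ)
        + (B a (B b ψ) - B (b + a) ψ) + -(H (a + b) ψ - B (a + b) ψ) := by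
      rw [map_sub, map_sub, hcH, add_comm b a]; abel
    rw [e]
    refine (norm_add_four_sq_le _ _ _ _).trans ?_
    rw [norm_neg]
    linarith [sq (hH b) (H a ψ - B a ψ), sq (hB a) (H b ψ - B b ψ)]
  refine (expect_mono fun a => expect_mono fun b => p2 a b).trans ?_
  simp only [← Finset.mul_expect, Finset.expect_add_distrib, Fintype.expect_const]
  have e1 : 𝔼 a, 𝔼 b, ‖H (a + b) ψ - B (a + b) ψ‖ ^ 2 = 𝔼 a, ‖H a ψ - B a ψ‖ ^ 2 := by
    simp only [expect_add_left _ fun c => ‖H c ψ - B c ψ‖ ^ 2, Fintype.expect_const]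
  have e2 : 𝔼 a, 𝔼 b, ‖B a (B b ψ) - B (b + a) ψ‖ ^ 2 =
      𝔼 a, 𝔼 b, ‖B b (B a ψ) - B (a + b) ψ‖ ^ 2 := Finset.expect_comm _ _ _
  rw [e1, e2]
  linarith

end Expect

end HilbertSpace

/-! ### Signed sums of POVM elements -/

section POVM

variable {κ α : Type*} [Fintype κ] [DecidableEq κ] [Fintype α]

open scoped MatrixOrder Matrix.Norms.L2Operator in
theorem exists_eq_conjTranspose_mul_self {A : Matrix κ κ ℂ} (hA : A.PosSemidef) :
    ∃ B, A = Bᴴ * B :=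
  CStarAlgebra.nonneg_iff_eq_star_mul_self.mp hA.nonneg

theorem toEuclideanLin_mul_apply (A B : Matrix κ κ ℂ) (v : EuclideanSpace ℂ κ) :
    Matrix.toEuclideanLin (A * B) v = Matrix.toEuclideanLin A (Matrix.toEuclideanLin B v) := by
  simp [Matrix.toLpLin_mul_same]

theorem toEuclideanLin_one_apply (v : EuclideanSpace ℂ κ) :
    Matrix.toEuclideanLin (1 : Matrix κ κ ℂ) v = v := by
  simp

theorem inner_toEuclideanLin_left (A : Matrix κ κ ℂ) (v w : EuclideanSpace ℂ κ) :
    inner ℂ (Matrix.toEuclideanLin A v) w = inner ℂ v (Matrix.toEuclideanLin Aᴴ w) := by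
  rw [Matrix.toEuclideanLin_conjTranspose_eq_adjoint, LinearMap.adjoint_inner_right]

theorem IsObservable.isSymmContraction {A : Matrix κ κ ℂ} (hA : IsObservable A) :
    IsSymmContraction (Matrix.toEuclideanLin A) where
  symm v w := by rw [inner_toEuclideanLin_left, hA.1]
  norm_le v := by
    refine le_of_eq ((sq_eq_sq₀ (norm_nonneg _) (norm_nonneg _)).1 ?_)
    rw [← inner_self_eq_norm_sq (𝕜 := ℂ), ← inner_self_eq_norm_sq (𝕜 := ℂ),
      inner_toEuclideanLin_left, hA.1, ← toEuclideanLin_mul_apply, hA.2,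
      toEuclideanLin_one_apply]

/-- The operator `∑ₓ f(x) Mₓ` for a choice of signs `f`. -/
noncomputable def signedSum {κ α : Type*} [Fintype α] (f : α → ℤˣ) (M : α → Matrix κ κ ℂ) : Matrix κ κ ℂ :=
  ∑ x, ((f x : ℤ) : ℂ) • M x

theorem signedSum_one {M : α → Matrix κ κ ℂ} (hM : IsPOVM M) : signedSum 1 M = 1 := by
  simp [signedSum, hM.2]

/-- With `M x = (N x)ᴴ N x`, the map `v ↦ (N x v)ₓ` is the Naimark isometry; its adjoint is a
contraction, and here it is applied to `(N x (w x))ₓ`. This serves in place of dilating the POVM to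
a projective measurement. -/
theorem IsPOVM.norm_sum_sq_le {M : α → Matrix κ κ ℂ} (hM : IsPOVM M)
    (w : α → EuclideanSpace ℂ κ) :
    ‖∑ x, Matrix.toEuclideanLin (M x) (w x)‖ ^ 2
      ≤ ∑ x, (inner ℂ (w x) (Matrix.toEuclideanLin (M x) (w x))).re := by
  choose N hN using fun x => exists_eq_conjTranspose_mul_self (hM.1 x)
  have hi : ∀ x u v, inner ℂ u (Matrix.toEuclideanLin (M x) v) =
      inner ℂ (Matrix.toEuclideanLin (N x) u) (Matrix.toEuclideanLin (N x) v) := by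
    intro x u v
    rw [hN x, toEuclideanLin_mul_apply, inner_toEuclideanLin_left]
  set v := ∑ x, Matrix.toEuclideanLin (M x) (w x) with hv
  have h1 : ‖v‖ ^ 2 = ∑ x, (inner ℂ (Matrix.toEuclideanLin (N x) v)
      (Matrix.toEuclideanLin (N x) (w x))).re := by
    rw [← inner_self_eq_norm_sq (𝕜 := ℂ), RCLike.re_eq_complex_re]
    conv_lhs => rw [hv, inner_sum, ← hv, Complex.re_sum]
    exact Finset.sum_congr rfl fun x _ => by rw [hi]
  have h2 : ‖v‖ ^ 2 = ∑ x, ‖Matrix.toEuclideanLin (N x) v‖ ^ 2 := by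
    have : v = ∑ x, Matrix.toEuclideanLin (M x) v := by
      rw [← LinearMap.sum_apply, ← map_sum, hM.2, toEuclideanLin_one_apply]
    rw [← inner_self_eq_norm_sq (𝕜 := ℂ), RCLike.re_eq_complex_re]
    conv_lhs => rw [this, inner_sum, ← this, Complex.re_sum]
    refine Finset.sum_congr rfl fun x _ => ?_
    rw [hi, ← inner_self_eq_norm_sq (𝕜 := ℂ), RCLike.re_eq_complex_re]
  have h3 : ∑ x, (inner ℂ (Matrix.toEuclideanLin (N x) v)
      (Matrix.toEuclideanLin (N x) (w x))).re ≤ ∑ x, (‖Matrix.toEuclideanLin (N x) v‖ ^ 2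
        + ‖Matrix.toEuclideanLin (N x) (w x)‖ ^ 2) / 2 := by
    refine Finset.sum_le_sum fun x _ => ?_
    have := (abs_le.1 (abs_re_inner_le_norm (Matrix.toEuclideanLin (N x) v)
      (Matrix.toEuclideanLin (N x) (w x)))).2
    nlinarith [sq_nonneg (‖Matrix.toEuclideanLin (N x) v‖ - ‖Matrix.toEuclideanLin (N x) (w x)‖)]
  rw [← Finset.sum_div, Finset.sum_add_distrib, ← h1, ← h2] at h3
  have h4 : ∑ x, (inner ℂ (w x) (Matrix.toEuclideanLin (M x) (w x))).re =
      ∑ x, ‖Matrix.toEuclideanLin (N x) (w x)‖ ^ 2 := by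
    refine Finset.sum_congr rfl fun x _ => ?_
    rw [hi, ← inner_self_eq_norm_sq (𝕜 := ℂ), RCLike.re_eq_complex_re]
  rw [h4]
  linarith

theorem signedSum_apply (f : α → ℤˣ) (M : α → Matrix κ κ ℂ) (v : EuclideanSpace ℂ κ) :
    Matrix.toEuclideanLin (signedSum f M) v =
      ∑ x, Matrix.toEuclideanLin (M x) (((f x : ℤ) : ℂ) • v) := by
  simp [signedSum]

/-- For the norm, take `w x = ± v` in `norm_sum_sq_le`: the signs cancel in each quadratic form and
the forms add up to `‖v‖²`. -/
theorem IsPOVM.isSymmContraction_signedSum {M : α → Matrix κ κ ℂ} (hM : IsPOVM M)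
    (f : α → ℤˣ) : IsSymmContraction (Matrix.toEuclideanLin (signedSum f M)) where
  symm v w := by
    rw [inner_toEuclideanLin_left, signedSum, Matrix.conjTranspose_sum]
    congr 3
    refine Finset.sum_congr rfl fun x _ => ?_
    rw [Matrix.conjTranspose_smul, (hM.1 x).isHermitian]
    simp
  norm_le v := by
    refine (sq_le_sq₀ (norm_nonneg _) (norm_nonneg _)).1 ?_
    rw [signedSum_apply]
    refine (hM.norm_sum_sq_le _).trans (le_of_eq ?_)
    have : ∀ x, (inner ℂ (((f x : ℤ) : ℂ) • v)
        (Matrix.toEuclideanLin (M x) (((f x : ℤ) : ℂ) • v))).re =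
        (inner ℂ v (Matrix.toEuclideanLin (M x) v)).re := by
      intro x
      rcases Int.units_eq_one_or (f x) with h | h <;> simp [h]
    simp only [this]
    rw [← Complex.re_sum, ← inner_sum, ← LinearMap.sum_apply, ← map_sum, hM.2,
      toEuclideanLin_one_apply, ← inner_self_eq_norm_sq (𝕜 := ℂ), RCLike.re_eq_complex_re]

/-- For a projective measurement the signed sums would multiply exactly. In general the defect is
bounded by a variance: with `u` the image of `v` under the signed sum of `g`, apply `norm_sum_sq_le`
to `w x = f(x)(g(x) v - u)`; the forms add up to `‖v‖² - 2‖u‖² + ‖u‖²`. -/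
theorem IsPOVM.norm_signedSum_mul_sub_sq_le {M : α → Matrix κ κ ℂ} (hM : IsPOVM M)
    (f g : α → ℤˣ) (v : EuclideanSpace ℂ κ) :
    ‖Matrix.toEuclideanLin (signedSum (f * g) M) v
        - Matrix.toEuclideanLin (signedSum f M) (Matrix.toEuclideanLin (signedSum g M) v)‖ ^ 2
      ≤ ‖v‖ ^ 2 - ‖Matrix.toEuclideanLin (signedSum g M) v‖ ^ 2 := by
  set u := Matrix.toEuclideanLin (signedSum g M) v with hu
  have e : Matrix.toEuclideanLin (signedSum (f * g) M) v
        - Matrix.toEuclideanLin (signedSum f M) u =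
      ∑ x, Matrix.toEuclideanLin (M x) (((f x : ℤ) : ℂ) • (((g x : ℤ) : ℂ) • v - u)) := by
    rw [signedSum_apply, signedSum_apply, ← Finset.sum_sub_distrib]
    refine Finset.sum_congr rfl fun x _ => ?_
    simp [smul_sub, smul_smul]
  rw [e]
  refine (hM.norm_sum_sq_le _).trans (le_of_eq ?_)
  have c1 : ∀ x (w : EuclideanSpace ℂ κ), (inner ℂ (((f x : ℤ) : ℂ) • w)
      (Matrix.toEuclideanLin (M x) (((f x : ℤ) : ℂ) • w))).re =
      (inner ℂ w (Matrix.toEuclideanLin (M x) w)).re := by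
    intro x w
    rcases Int.units_eq_one_or (f x) with h | h <;> simp [h]
  have c2 : ∀ x, (inner ℂ (((g x : ℤ) : ℂ) • v - u)
      (Matrix.toEuclideanLin (M x) (((g x : ℤ) : ℂ) • v - u))).re =
      (inner ℂ v (Matrix.toEuclideanLin (M x) v)).re
      - (inner ℂ u (Matrix.toEuclideanLin (M x) (((g x : ℤ) : ℂ) • v))).re
      - (inner ℂ (Matrix.toEuclideanLin (M x) (((g x : ℤ) : ℂ) • v)) u).re
      + (inner ℂ u (Matrix.toEuclideanLin (M x) u)).re := by
    intro x
    have : inner ℂ (Matrix.toEuclideanLin (M x) v) u = inner ℂ v (Matrix.toEuclideanLin (M x) u) := by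
      rw [inner_toEuclideanLin_left, (hM.1 x).isHermitian]
    rcases Int.units_eq_one_or (g x) with h | h
    all_goals
      simp only [h, Units.val_one, Units.val_neg, Int.cast_one, Int.cast_neg, one_smul, neg_smul,
        map_sub, map_neg, inner_sub_left, inner_sub_right, inner_neg_left, inner_neg_right, this,
        Complex.sub_re, Complex.neg_re]
      ring
  simp only [c1, c2, Finset.sum_add_distrib, Finset.sum_sub_distrib, ← Complex.re_sum, ← inner_sum,
    ← sum_inner]
  rw [← signedSum_apply, ← hu]
  simp only [← LinearMap.sum_apply, ← map_sum, hM.2, toEuclideanLin_one_apply]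
  simp only [← inner_self_eq_norm_sq (𝕜 := ℂ), RCLike.re_eq_complex_re]
  ring

theorem isSymmContraction_average {E : Type*} [NormedAddCommGroup E] [InnerProductSpace ℂ E]
    {n : ℕ} {A : Str n → E →ₗ[ℂ] E} (hA : ∀ c, IsSymmContraction (A c)) :
    IsSymmContraction (((1 : ℂ) / 2 ^ n) • ∑ c, A c) where
  symm v w := by
    simp only [LinearMap.smul_apply, LinearMap.sum_apply, inner_smul_left, inner_smul_right,
      sum_inner, inner_sum, (hA _).symm]
    simp [Complex.conj_ofNat]
  norm_le v := by
    have h : ‖∑ c, A c v‖ ≤ ∑ c : Str n, ‖v‖ := norm_sum_le_of_le _ fun c _ => (hA c).norm_le v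
    rw [Finset.sum_const, Finset.card_univ, Fintype.card_fun, ZMod.card, Fintype.card_fin] at h
    rw [LinearMap.smul_apply, LinearMap.sum_apply, norm_smul]
    have h2 : ‖(1 : ℂ) / 2 ^ n‖ = 1 / 2 ^ n := by simp
    rw [h2, one_div, inv_mul_le_iff₀ (by positivity)]
    simpa using h

theorem re_inner_average {E : Type*} [NormedAddCommGroup E] [InnerProductSpace ℂ E]
    {n : ℕ} (u : E) (v : Str n → E) :
    (inner ℂ u (((1 : ℂ) / 2 ^ n) • ∑ c, v c)).re = 𝔼 c, (inner ℂ u (v c)).re := by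
  rw [Fintype.expect_eq_sum_div_card, inner_smul_right, inner_sum,
    show (1 : ℂ) / 2 ^ n = ((1 / 2 ^ n : ℝ) : ℂ) by push_cast; rfl, Complex.re_ofReal_mul,
    Complex.re_sum]
  simp [div_eq_inv_mul]

theorem re_inner_average_left {E : Type*} [NormedAddCommGroup E] [InnerProductSpace ℂ E]
    {n : ℕ} (u : Str n → E) (v : E) :
    (inner ℂ (((1 : ℂ) / 2 ^ n) • ∑ c, u c) v).re = 𝔼 c, (inner ℂ (u c) v).re := by
  rw [← inner_conj_symm, Complex.conj_re, re_inner_average]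
  refine Finset.expect_congr rfl fun c _ => ?_
  rw [← inner_conj_symm, Complex.conj_re]

end POVM

/-! ### Tensor products -/

section Tensor

variable {κ : Type*} [Fintype κ] [DecidableEq κ] {ι : κ → Type*} [∀ j, Fintype (ι j)]
  [∀ j, DecidableEq (ι j)]

theorem tensorOp_posSemidef {A : ∀ j, Matrix (ι j) (ι j) ℂ} (hA : ∀ j, (A j).PosSemidef) :
    (tensorOp A).PosSemidef := by
  choose N hN using fun x => exists_eq_conjTranspose_mul_self (hA x)
  rw [funext hN, ← tensorOp_mul, ← tensorOp_conjTranspose]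
  exact Matrix.posSemidef_conjTranspose_mul_self _

theorem tensorOp_sum {α : Type*} [Fintype α] [DecidableEq α] {ι : κ → Type*}
    (M : ∀ j, α → Matrix (ι j) (ι j) ℂ) :
    tensorOp (fun j => ∑ x, M j x) = ∑ f : κ → α, tensorOp fun j => M j (f j) := by
  ext x y
  simp only [tensorOp, Matrix.sum_apply, Matrix.of_apply]
  exact Fintype.prod_sum fun j z => M j z (x j) (y j)

theorem tensorOp_signedSum {α : Type*} [Fintype α] [DecidableEq α] {ι : κ → Type*} (f : κ → α → ℤˣ)
    (M : ∀ j, α → Matrix (ι j) (ι j) ℂ) :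
    tensorOp (fun j => signedSum (f j) (M j)) =
      signedSum (fun x : κ → α => ∏ j, f j (x j)) (fun x => tensorOp fun j => M j (x j)) := by
  unfold signedSum
  rw [tensorOp_sum]
  refine Finset.sum_congr rfl fun x _ => ?_
  rw [tensorOp_smul]
  congr 1
  push_cast
  rfl

theorem IsPOVM.tensorOp {α : Type*} [Fintype α] [DecidableEq α]
    {M : ∀ j, α → Matrix (ι j) (ι j) ℂ} (hM : ∀ j, IsPOVM (M j)) :
    IsPOVM fun x : κ → α => tensorOp fun j => M j (x j) := by
  refine ⟨fun x => tensorOp_posSemidef fun j => (hM j).1 _, ?_⟩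
  rw [← tensorOp_sum, ← tensorOp_one]
  congr 1
  funext j
  exact (hM j).2

/-- The operator acting as `A` on register `i` and as the identity on the other registers. -/
noncomputable def localOp (i : κ) :
    Matrix (ι i) (ι i) ℂ →ₐ[ℂ] Matrix (∀ j, ι j) (∀ j, ι j) ℂ :=
  -- With the factor at `i` split off, linearity in `A` can be read off entrywise.
  have h : ∀ A : Matrix (ι i) (ι i) ℂ, tensorOp (Function.update (fun _ => 1) i A) =
      Matrix.of fun x y => A (x i) (y i) *
        ∏ j ∈ Finset.univ.erase i, (1 : Matrix (ι j) (ι j) ℂ) (x j) (y j) := by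
    intro A
    ext x y
    rw [tensorOp, Matrix.of_apply, Matrix.of_apply,
      ← Finset.mul_prod_erase Finset.univ _ (Finset.mem_univ i), Function.update_self]
    congr 1
    refine Finset.prod_congr rfl fun j hj => ?_
    rw [Function.update_of_ne (Finset.ne_of_mem_erase hj)]
  AlgHom.ofLinearMap
    { toFun := fun A => tensorOp (Function.update (fun _ => 1) i A)
      map_add' := fun A B => by
        simp only [h]
        ext x y
        simp [add_mul]
      map_smul' := fun c A => by
        simp only [h]
        ext x y
        simp [mul_assoc] }
    (by
      change tensorOp (Function.update _ i 1) = 1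
      rw [← tensorOp_one]
      congr 1
      exact Function.update_eq_self i _)
    (fun A B => by
      change tensorOp _ = tensorOp _ * tensorOp _
      rw [tensorOp_mul]
      congr 1
      funext j
      rcases eq_or_ne j i with rfl | hj
      · simp
      · simp [Function.update_of_ne hj])

theorem localOp_def (i : κ) (A : Matrix (ι i) (ι i) ℂ) :
    localOp i A = tensorOp (Function.update (fun _ => 1) i A) := rfl

theorem localOp_apply (i : κ) (A : Matrix (ι i) (ι i) ℂ) (x y : ∀ j, ι j) :
    localOp i A x y = A (x i) (y i) *
      ∏ j ∈ Finset.univ.erase i, (1 : Matrix (ι j) (ι j) ℂ) (x j) (y j) := by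
  rw [localOp_def, tensorOp, Matrix.of_apply,
    ← Finset.mul_prod_erase Finset.univ _ (Finset.mem_univ i), Function.update_self]
  congr 1
  refine Finset.prod_congr rfl fun j hj => ?_
  rw [Function.update_of_ne (Finset.ne_of_mem_erase hj)]

theorem localOp_mul_tensorOp (i : κ) (A : Matrix (ι i) (ι i) ℂ)
    {T : ∀ j, Matrix (ι j) (ι j) ℂ} (hT : T i = 1) :
    localOp i A * tensorOp T = tensorOp (Function.update T i A) := by
  rw [localOp_def, tensorOp_mul]
  congr 1
  funext j
  rcases eq_or_ne j i with rfl | hj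
  · simp [hT]
  · simp [Function.update_of_ne hj]

theorem tensorOp_mul_localOp (i : κ) (A : Matrix (ι i) (ι i) ℂ)
    {T : ∀ j, Matrix (ι j) (ι j) ℂ} (hT : T i = 1) :
    tensorOp T * localOp i A = tensorOp (Function.update T i A) := by
  rw [localOp_def, tensorOp_mul]
  congr 1
  funext j
  rcases eq_or_ne j i with rfl | hj
  · simp [hT]
  · simp [Function.update_of_ne hj]

theorem IsPOVM.localOp {α : Type*} [Fintype α] (i : κ) {M : α → Matrix (ι i) (ι i) ℂ}
    (hM : IsPOVM M) : IsPOVM fun x => localOp i (M x) := by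
  refine ⟨fun x => tensorOp_posSemidef fun j => ?_, ?_⟩
  · rcases eq_or_ne j i with rfl | hj
    · simpa using hM.1 x
    · simpa [Function.update_of_ne hj] using Matrix.PosSemidef.one
  · rw [← map_sum, hM.2, map_one]

theorem localOp_signedSum {α : Type*} [Fintype α] (i : κ) (f : α → ℤˣ)
    (M : α → Matrix (ι i) (ι i) ℂ) :
    localOp i (signedSum f M) = signedSum f fun x => localOp i (M x) := by
  simp [signedSum, map_sum, map_smul]

end Tensor

/-! ### Dilation to exactly linear observables -/

section Dilation

/-- Conjugating an exactly linear family of observables by a self-inverse unitary that maps the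
range of the isometry `J` to that of the isometry `V`. -/
theorem exists_conj_linear_observables {κ ι G : Type*} [Fintype κ] [DecidableEq κ] [Fintype ι]
    [DecidableEq ι] [Add G] {J V : Matrix κ ι ℂ} (hJ : Jᴴ * J = 1) (hV : Vᴴ * V = 1)
    (hJV : Jᴴ * V = 0) {D : G → Matrix κ κ ℂ} (hD : ∀ a, IsObservable (D a))
    (hDD : ∀ a b, D a * D b = D (a + b)) :
    ∃ X : G → Matrix κ κ ℂ, (∀ a, IsObservable (X a)) ∧ (∀ a b, X a * X b = X (a + b)) ∧
      ∀ a, Jᴴ * X a * J = Vᴴ * D a * V := by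
  have hVJ : Vᴴ * J = 0 := by
    simpa using congrArg Matrix.conjTranspose hJV
  -- `U` swaps the ranges of `J` and `V` and fixes the orthogonal complement of both; orthogonality
  -- of the ranges makes it a self-inverse unitary.
  set U : Matrix κ κ ℂ := 1 - J * Jᴴ - V * Vᴴ + V * Jᴴ + J * Vᴴ with hU
  have hUJ : U * J = V := by
    simp [hU, Matrix.add_mul, Matrix.sub_mul, Matrix.mul_assoc, hJ, hVJ]
  have hUV : U * V = J := by
    simp [hU, Matrix.add_mul, Matrix.sub_mul, Matrix.mul_assoc, hV, hJV]
  have hUU : U * U = 1 := by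
    conv_lhs => rhs; rw [hU]
    rw [Matrix.mul_add, Matrix.mul_add, Matrix.mul_sub, Matrix.mul_sub, ← Matrix.mul_assoc,
      ← Matrix.mul_assoc, ← Matrix.mul_assoc, ← Matrix.mul_assoc, hUJ, hUV, hU]
    simp only [Matrix.mul_one]
    abel
  have hUh : Uᴴ = U := by
    simp [hU, Matrix.conjTranspose_mul]
    abel
  refine ⟨fun a => U * D a * U, fun a => ⟨?_, ?_⟩, fun a b => ?_, fun a => ?_⟩
  · unfold Matrix.IsHermitian
    simp only [Matrix.conjTranspose_mul, hUh, (hD a).1.eq, Matrix.mul_assoc]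
  · calc U * D a * U * (U * D a * U) = U * D a * (U * U) * D a * U := by noncomm_ring
      _ = 1 := by rw [hUU, mul_one, mul_assoc U, (hD a).2, mul_one, hUU]
  · calc U * D a * U * (U * D b * U) = U * D a * (U * U) * D b * U := by noncomm_ring
      _ = U * D (a + b) * U := by rw [hUU, mul_one, mul_assoc U, hDD]
  · have hJU : Jᴴ * U = Vᴴ := by
      rw [← hUh, ← Matrix.conjTranspose_mul, hUJ]
    calc Jᴴ * (U * D a * U) * J = (Jᴴ * U) * D a * (U * J) := by
          simp only [Matrix.mul_assoc]
      _ = Vᴴ * D a * V := by rw [hJU, hUJ]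

theorem str_add_self {n : ℕ} (a : Str n) : a + a = 0 := by
  funext k; exact CharTwo.add_self_eq_zero _

/-- Translations of `Str n` are exactly linear observables, since every string is its own negative.
They are compressed by the isometry built from `H`, with a defect term that restores unit norm. -/
theorem exists_linear_observables_aux {n : ℕ} {ι : Type*} [Fintype ι] [DecidableEq ι]
    {H : Str n → Matrix ι ι ℂ} (hH : ∀ a, (H a).IsHermitian)
    (hpos : (1 - ((1 : ℂ) / 2 ^ n) • ∑ b, H b * H b).PosSemidef) :
    ∃ X : Str n → Matrix (ι × (Fin 4 × Str n)) (ι × (Fin 4 × Str n)) ℂ,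
      (∀ a, IsObservable (X a)) ∧ (∀ a b, X a * X b = X (a + b)) ∧
      ∀ a, (X a).submatrix (fun x => (x, 0)) (fun x => (x, 0)) =
        ((1 : ℂ) / 2 ^ n) • ∑ b, H b * H (a + b)
          + (1 - ((1 : ℂ) / 2 ^ n) • ∑ b, H b * H b) := by
  obtain ⟨G, hG⟩ := exists_eq_conjTranspose_mul_self hpos
  set c : ℂ := ((√(1 / 2 ^ n) : ℝ) : ℂ) with hc
  have hcs : star c = c := Complex.conj_ofReal _
  have hcc : c * c = 1 / 2 ^ n := by
    rw [hc, ← Complex.ofReal_mul, Real.mul_self_sqrt (by positivity)]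
    push_cast; rfl
  -- Block `1` carries `H`; block `2` carries the constant `G`, which completes `V` to an isometry.
  -- Block `0` is empty so that `V` is orthogonal to `J`, whose range lies there; block `3` only
  -- pads the dimension to a power of two.
  let W : Fin 4 × Str n → Matrix ι ι ℂ := fun k => c • ![0, H k.2, G, 0] k.1
  let V : Matrix (ι × (Fin 4 × Str n)) ι ℂ := Matrix.of fun x y => W x.2 x.1 y
  let J : Matrix (ι × (Fin 4 × Str n)) ι ℂ := Matrix.of fun x y =>
    if x.2 = 0 then (1 : Matrix ι ι ℂ) x.1 y else 0
  -- Translation by `a` within each block. It leaves the constant block `G` unchanged, so the defect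
  -- contributes `Gᴴ * G` for every `a`.
  let D : Str n → Matrix (ι × (Fin 4 × Str n)) (ι × (Fin 4 × Str n)) ℂ := fun a =>
    Matrix.of fun x y => if y = (x.1, (x.2.1, a + x.2.2)) then 1 else 0
  have hDmul : ∀ (a : Str n) {τ : Type _} (M : Matrix (ι × (Fin 4 × Str n)) τ ℂ) x y,
      (D a * M) x y = M (x.1, (x.2.1, a + x.2.2)) y := by
    intro a τ M x y
    simp [D, Matrix.mul_apply]
  have key : ∀ a, Vᴴ * D a * V = ((1 : ℂ) / 2 ^ n) • ∑ b, H b * H (a + b)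
          + (1 - ((1 : ℂ) / 2 ^ n) • ∑ b, H b * H b) := by
    intro a
    have h1 : Vᴴ * D a * V = ∑ f, ∑ b, (W (f, b))ᴴ * W (f, a + b) := by
      ext x y
      have h0 : (Vᴴ * (D a * V)) x y =
          ∑ k : ι × (Fin 4 × Str n), star (V k x) * V (k.1, (k.2.1, a + k.2.2)) y :=
        Finset.sum_congr rfl fun k _ => congrArg (star (V k x) * ·) (hDmul a V k y)
      rw [Matrix.mul_assoc, h0]
      simp only [Fintype.sum_prod_type, Matrix.sum_apply, Matrix.mul_apply]
      rw [Finset.sum_comm]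
      refine Finset.sum_congr rfl fun f _ => ?_
      rw [Finset.sum_comm]
      rfl
    have h2 : ∑ b : Str n, (c • G)ᴴ * (c • G) = Gᴴ * G := by
      rw [Finset.sum_const, Finset.card_univ, Fintype.card_fun, ZMod.card, Fintype.card_fin,
        Matrix.conjTranspose_smul, hcs, Matrix.smul_mul, Matrix.mul_smul, smul_smul, hcc,
        ← Nat.cast_smul_eq_nsmul ℂ, smul_smul]
      push_cast
      rw [mul_one_div_cancel (by positivity), one_smul]
    have h3 : ∀ b, (c • H b)ᴴ * (c • H (a + b)) = ((1 : ℂ) / 2 ^ n) • (H b * H (a + b)) := by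
      intro b
      rw [Matrix.conjTranspose_smul, hcs, Matrix.smul_mul, Matrix.mul_smul, smul_smul, hcc, hH b]
    rw [h1, Fin.sum_univ_four, hG, ← h2, Finset.smul_sum]
    simp only [← h3]
    simp [W]
  have hDD : ∀ a b, D a * D b = D (a + b) := by
    intro a b
    ext x y
    rw [hDmul]
    simp [D, add_left_comm, add_comm]
  have hD0 : D 0 = 1 := by
    ext x y
    simp [D, Matrix.one_apply, eq_comm]
  have hD : ∀ a, IsObservable (D a) := by
    refine fun a => ⟨?_, by rw [hDD, str_add_self, hD0]⟩
    ext x y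
    have : ∀ b c : Str n, b = a + c ↔ c = a + b := by
      intro b c
      constructor <;> rintro rfl <;> rw [← add_assoc, str_add_self, zero_add]
    simp only [D, Matrix.conjTranspose_apply, Matrix.of_apply, Prod.ext_iff, this x.2.2 y.2.2,
      eq_comm (a := x.1), eq_comm (a := x.2.1)]
    split_ifs <;> simp
  have hJmul : ∀ {τ : Type _} (M : Matrix (ι × (Fin 4 × Str n)) τ ℂ),
      Jᴴ * M = M.submatrix (fun x => (x, 0)) id := by
    intro τ M
    ext x y
    rw [Matrix.mul_apply, Finset.sum_eq_single (x, 0)]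
    · simp [J]
    · rintro ⟨z, k⟩ - hz
      by_cases hk : k = 0
      · have : z ≠ x := fun h => hz (by rw [h, hk])
        simp [J, hk, Matrix.one_apply_ne this]
      · simp [J, hk]
    · simp
  have hmulJ : ∀ (M : Matrix ι (ι × (Fin 4 × Str n)) ℂ),
      M * J = M.submatrix id (fun x => (x, 0)) := by
    intro M
    have := congrArg Matrix.conjTranspose (hJmul Mᴴ)
    simpa [Matrix.conjTranspose_mul, Matrix.conjTranspose_submatrix] using this
  have hJJ : Jᴴ * J = 1 := by
    rw [hJmul]
    ext x y
    simp [J]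
  have hVV : Vᴴ * V = 1 := by
    have := key 0
    rw [hD0, Matrix.mul_one] at this
    rw [this]
    simp
  have hJV : Jᴴ * V = 0 := by
    rw [hJmul]
    ext x y
    simp [V, W]
  obtain ⟨X, hX, hXX, hXJ⟩ := exists_conj_linear_observables hJJ hVV hJV hD hDD
  refine ⟨X, hX, hXX, fun a => ?_⟩
  rw [← key, ← hXJ, hJmul, hmulJ, Matrix.submatrix_submatrix]
  rfl

/-- If the operators `H a` are Hermitian contractions on average, then there are exactly linear
observables on `n + 2` additional qubits whose compression is close to `H` when `H` is
approximately linear. -/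
theorem exists_linear_observables {n : ℕ} {ι : Type*} [Fintype ι] [DecidableEq ι]
    {H : Str n → Matrix ι ι ℂ} (hH : ∀ a, (H a).IsHermitian)
    (hpos : (1 - ((1 : ℂ) / 2 ^ n) • ∑ b, H b * H b).PosSemidef) :
    ∃ X : Str n → Matrix (ι × Anc (n + 2)) (ι × Anc (n + 2)) ℂ,
      (∀ a, IsObservable (X a)) ∧ (∀ a b, X a * X b = X (a + b)) ∧
      ∀ a, (X a).submatrix (fun x => (x, 0)) (fun x => (x, 0)) =
        ((1 : ℂ) / 2 ^ n) • ∑ b, H b * H (a + b)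
          + (1 - ((1 : ℂ) / 2 ^ n) • ∑ b, H b * H b) := by
  obtain ⟨X, hX, hXX, hXc⟩ := exists_linear_observables_aux hH hpos
  have hcard : Fintype.card (Anc (n + 2)) = Fintype.card (Fin 4 × Str n) := by
    simp [ZMod.card, pow_add, mul_comm]
  -- The relabelling must send `0` to `0`, so that the distinguished ancilla state becomes `|0^m⟩`;
  -- a swap achieves this.
  obtain ⟨e, he⟩ : ∃ e : Anc (n + 2) ≃ Fin 4 × Str n, e 0 = 0 := by
    let e₀ := Fintype.equivOfCardEq hcard
    exact ⟨e₀.trans (Equiv.swap (e₀ 0) 0), by simp⟩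
  let E : ι × Anc (n + 2) ≃ ι × (Fin 4 × Str n) := Equiv.prodCongr (Equiv.refl ι) e
  refine ⟨fun a => (X a).submatrix E E, fun a => ⟨(hX a).1.submatrix E, ?_⟩, fun a b => ?_,
    fun a => ?_⟩
  · rw [Matrix.submatrix_mul_equiv, (hX a).2, Matrix.submatrix_one_equiv]
  · rw [Matrix.submatrix_mul_equiv, hXX]
  · rw [← hXc, Matrix.submatrix_submatrix]
    ext x y
    simp [E, he]

/-- The average of the squares of symmetric contractions is at most `1`. -/
theorem posSemidef_one_sub_average_sq {n : ℕ} {ι : Type*} [Fintype ι] [DecidableEq ι]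
    {H : Str n → Matrix ι ι ℂ} (hH : ∀ a, (H a).IsHermitian)
    (hc : ∀ a, IsSymmContraction (Matrix.toEuclideanLin (H a))) :
    (1 - ((1 : ℂ) / 2 ^ n) • ∑ b, H b * H b).PosSemidef := by
  have h1 : ∀ b, (1 - H b * H b).PosSemidef := by
    intro b
    have hh : (1 - H b * H b).IsHermitian := by
      unfold Matrix.IsHermitian
      rw [Matrix.conjTranspose_sub, Matrix.conjTranspose_mul, hH b, Matrix.conjTranspose_one]
    rw [← Matrix.isPositive_toEuclideanLin_iff]
    refine ⟨Matrix.isSymmetric_toEuclideanLin_iff.2 hh, fun v => ?_⟩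
    rw [map_sub, LinearMap.sub_apply, toEuclideanLin_mul_apply, toEuclideanLin_one_apply,
      inner_sub_left, (hc b).symm, map_sub, inner_self_eq_norm_sq, inner_self_eq_norm_sq]
    have := pow_le_pow_left₀ (norm_nonneg _) ((hc b).norm_le v) 2
    linarith
  have h2 : 1 - ((1 : ℂ) / 2 ^ n) • ∑ b, H b * H b =
      ((1 : ℂ) / 2 ^ n) • ∑ b, (1 - H b * H b) := by
    rw [Finset.sum_sub_distrib, smul_sub, Finset.sum_const, Finset.card_univ, Fintype.card_fun,
      ZMod.card, Fintype.card_fin, ← Nat.cast_smul_eq_nsmul ℂ, smul_smul]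
    push_cast
    rw [one_div_mul_cancel (by positivity), one_smul]
  rw [h2]
  refine (Matrix.posSemidef_sum _ fun b _ => h1 b).smul ?_
  positivity

end Dilation

/-! ### Operators on the extended register of one prover -/

section Ancilla

variable {r : ℕ} {ι : Fin r → Type*} [∀ j, Fintype (ι j)] [∀ j, DecidableEq (ι j)]

/-- Separates the extended register of prover `i` from the registers of the other provers. -/
def proverEquiv (ι : Fin r → Type*) (i : Fin r) (m : ℕ) :
    (∀ j, ι j) × Anc m ≃ (ι i × Anc m) × (∀ j : {j // j ≠ i}, ι j) where
  toFun x := ((x.1 i, x.2), fun j => x.1 j)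
  invFun x := ((Equiv.piSplitAt i ι).symm (x.1.1, x.2), x.1.2)
  left_inv x := Prod.ext ((Equiv.piSplitAt i ι).symm_apply_apply x.1) rfl
  right_inv x := by
    have := (Equiv.piSplitAt i ι).apply_symm_apply (x.1.1, x.2)
    have h₁ := congrArg Prod.fst this
    have h₂ := congrArg Prod.snd this
    exact Prod.ext (Prod.ext h₁ rfl) h₂

theorem prod_subtype_ne {M : Type*} [CommMonoid M] (i : Fin r) (f : Fin r → M) :
    ∏ j : {j // j ≠ i}, f j = ∏ j ∈ Finset.univ.erase i, f j :=
  (Finset.prod_subtype _ (by simp) f).symm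

theorem onProver_eq_submatrix {ι : Fin r → Type*} [∀ j, DecidableEq (ι j)]
    (i : Fin r) (m : ℕ) (A : Matrix (ι i × Anc m) (ι i × Anc m) ℂ) :
    onProver i m A = (A ⊗ₖ (1 : Matrix (∀ j : {j // j ≠ i}, ι j) _ ℂ)).submatrix
      (proverEquiv ι i m) (proverEquiv ι i m) := by
  ext x y
  simp only [onProver, Matrix.of_apply, Matrix.submatrix_apply, Matrix.kroneckerMap_apply,
    proverEquiv, Equiv.coe_fn_mk]
  rw [← tensorOp_one, tensorOp, Matrix.of_apply,
    prod_subtype_ne i fun j => (1 : Matrix (ι j) (ι j) ℂ) (x.1 j) (y.1 j)]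

theorem onProver_mul (i : Fin r) (m : ℕ) (A B : Matrix (ι i × Anc m) (ι i × Anc m) ℂ) :
    onProver i m (A * B) = onProver i m A * onProver i m B := by
  rw [onProver_eq_submatrix, onProver_eq_submatrix, onProver_eq_submatrix,
    Matrix.submatrix_mul_equiv, ← Matrix.mul_kronecker_mul, Matrix.one_mul]

theorem onProver_one {ι : Fin r → Type*} [∀ j, DecidableEq (ι j)]
    (i : Fin r) (m : ℕ) :
    onProver i m (1 : Matrix (ι i × Anc m) (ι i × Anc m) ℂ) = 1 := by
  rw [onProver_eq_submatrix, Matrix.one_kronecker_one, Matrix.submatrix_one_equiv]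

theorem onProver_sub {ι : Fin r → Type*} [∀ j, DecidableEq (ι j)]
    (i : Fin r) (m : ℕ) (A B : Matrix (ι i × Anc m) (ι i × Anc m) ℂ) :
    onProver i m (A - B) = onProver i m A - onProver i m B := by
  ext x y
  simp [onProver, sub_mul]

theorem onProver_smul {ι : Fin r → Type*} [∀ j, DecidableEq (ι j)]
    (i : Fin r) (m : ℕ) (c : ℂ) (A : Matrix (ι i × Anc m) (ι i × Anc m) ℂ) :
    onProver i m (c • A) = c • onProver i m A := by
  ext x y
  simp [onProver, mul_assoc]

theorem IsObservable.onProver {i : Fin r} {m : ℕ} {A : Matrix (ι i × Anc m) (ι i × Anc m) ℂ}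
    (hA : IsObservable A) : IsObservable (onProver i m A) := by
  refine ⟨?_, by rw [← onProver_mul, hA.2, onProver_one]⟩
  rw [onProver_eq_submatrix]
  refine Matrix.IsHermitian.submatrix ?_ _
  unfold Matrix.IsHermitian
  rw [Matrix.conjTranspose_kronecker, hA.1, Matrix.conjTranspose_one]

theorem onProver_kronecker_one (i : Fin r) (m : ℕ) (A : Matrix (ι i) (ι i) ℂ) :
    onProver i m (A ⊗ₖ (1 : Matrix (Anc m) (Anc m) ℂ)) =
      localOp i A ⊗ₖ (1 : Matrix (Anc m) (Anc m) ℂ) := by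
  ext x y
  simp only [onProver, Matrix.of_apply, Matrix.kroneckerMap_apply, localOp_apply]
  ring

/-- After regrouping by `proverEquiv`, the two operators act on different tensor factors. The
ancillas belong to prover `i`, so the composite observables still commute with the extended
register. -/
theorem onProver_mul_tensorOp (i : Fin r) (m : ℕ) (A : Matrix (ι i × Anc m) (ι i × Anc m) ℂ)
    {T : ∀ j, Matrix (ι j) (ι j) ℂ} (hT : T i = 1) :
    onProver i m A * (tensorOp T ⊗ₖ (1 : Matrix (Anc m) (Anc m) ℂ)) =
      (tensorOp T ⊗ₖ (1 : Matrix (Anc m) (Anc m) ℂ)) * onProver i m A := by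
  have h : tensorOp T ⊗ₖ (1 : Matrix (Anc m) (Anc m) ℂ) =
      ((1 : Matrix (ι i × Anc m) (ι i × Anc m) ℂ) ⊗ₖ
        tensorOp fun j : {j // j ≠ i} => T j).submatrix (proverEquiv ι i m)
          (proverEquiv ι i m) := by
    ext x y
    simp only [Matrix.submatrix_apply, Matrix.kroneckerMap_apply, proverEquiv, Equiv.coe_fn_mk,
      tensorOp, Matrix.of_apply]
    rw [prod_subtype_ne i fun j => T j (x.1 j) (y.1 j),
      ← Finset.mul_prod_erase Finset.univ _ (Finset.mem_univ i), hT, ← Matrix.one_kronecker_one,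
      Matrix.kroneckerMap_apply]
    ring
  rw [h, onProver_eq_submatrix, Matrix.submatrix_mul_equiv, Matrix.submatrix_mul_equiv,
    ← Matrix.mul_kronecker_mul, ← Matrix.mul_kronecker_mul]
  simp

theorem inner_withAncilla {ι : Fin r → Type*} [∀ j, Fintype (ι j)]
    (m : ℕ) (v w : EuclideanSpace ℂ (∀ j, ι j)) :
    inner ℂ (withAncilla m v) (withAncilla m w) = inner ℂ v w := by
  simp only [PiLp.inner_apply, withAncilla, Fintype.sum_prod_type]
  refine Finset.sum_congr rfl fun x _ => ?_
  rw [Finset.sum_eq_single 0]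
  · simp
  · intro p _ hp
    simp [hp]
  · simp

theorem norm_withAncilla {ι : Fin r → Type*} [∀ j, Fintype (ι j)]
    (m : ℕ) (v : EuclideanSpace ℂ (∀ j, ι j)) :
    ‖withAncilla m v‖ = ‖v‖ := by
  refine (sq_eq_sq₀ (norm_nonneg _) (norm_nonneg _)).1 ?_
  rw [← inner_self_eq_norm_sq (𝕜 := ℂ), ← inner_self_eq_norm_sq (𝕜 := ℂ), inner_withAncilla]

theorem withAncilla_sub {ι : Fin r → Type*}
    (m : ℕ) (v w : EuclideanSpace ℂ (∀ j, ι j)) :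
    withAncilla m (v - w) = withAncilla m v - withAncilla m w := by
  ext x
  by_cases h : x.2 = 0 <;> simp [withAncilla, h]

theorem withAncilla_add {ι : Fin r → Type*}
    (m : ℕ) (v w : EuclideanSpace ℂ (∀ j, ι j)) :
    withAncilla m (v + w) = withAncilla m v + withAncilla m w := by
  ext x
  by_cases h : x.2 = 0 <;> simp [withAncilla, h]

theorem toEuclideanLin_kronecker_one_withAncilla (m : ℕ)
    (A : Matrix (∀ j, ι j) (∀ j, ι j) ℂ) (v : EuclideanSpace ℂ (∀ j, ι j)) :
    Matrix.toEuclideanLin (A ⊗ₖ (1 : Matrix (Anc m) (Anc m) ℂ)) (withAncilla m v) =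
      withAncilla m (Matrix.toEuclideanLin A v) := by
  ext x
  simp only [withAncilla, Matrix.ofLp_toLpLin, Matrix.toLin'_apply, Matrix.mulVec, dotProduct,
    Matrix.kroneckerMap_apply, Fintype.sum_prod_type]
  by_cases h : x.2 = 0
  · simp [h, Matrix.one_apply]
  · simp [h, Matrix.one_apply]

/-- Only the entries of `A` with both ancilla indices `0` contribute. Thus correlations of the
dilated observables depend only on their compression, the one thing known about them besides
linearity. -/
theorem inner_onProver_withAncilla (i : Fin r) (m : ℕ)
    (A : Matrix (ι i × Anc m) (ι i × Anc m) ℂ) (v w : EuclideanSpace ℂ (∀ j, ι j)) :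
    inner ℂ (Matrix.toEuclideanLin (onProver i m A) (withAncilla m v)) (withAncilla m w) =
      inner ℂ (Matrix.toEuclideanLin (localOp i (A.submatrix (fun x => (x, 0)) fun x => (x, 0))) v)
        w := by
  simp only [PiLp.inner_apply, Fintype.sum_prod_type]
  refine Finset.sum_congr rfl fun x _ => ?_
  rw [Finset.sum_eq_single 0]
  · congr 1
    simp only [withAncilla, Matrix.ofLp_toLpLin, Matrix.toLin'_apply, Matrix.mulVec, dotProduct,
      Fintype.sum_prod_type, localOp_apply, Matrix.submatrix_apply, onProver, Matrix.of_apply]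
    · refine Finset.sum_congr rfl fun y _ => ?_
      rw [Finset.sum_eq_single 0]
      · simp
      · intro p _ hp
        simp [hp]
      · simp
    · simp [withAncilla]
  · intro p _ hp
    simp [withAncilla, hp]
  · simp

/-- `A ⊗ 1` acts as `A` on each slice with fixed second index, and inner products are sums over the
slices. -/
theorem IsSymmContraction.kronecker_one {κ τ : Type*} [Fintype κ] [DecidableEq κ] [Fintype τ]
    [DecidableEq τ] {A : Matrix κ κ ℂ} (hA : IsSymmContraction (Matrix.toEuclideanLin A)) :
    IsSymmContraction (Matrix.toEuclideanLin (A ⊗ₖ (1 : Matrix τ τ ℂ))) := by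
  let s : τ → EuclideanSpace ℂ (κ × τ) → EuclideanSpace ℂ κ :=
    fun p v => WithLp.toLp 2 fun x => v (x, p)
  have hinner : ∀ v w, inner ℂ v w = ∑ p, inner ℂ (s p v) (s p w) := by
    intro v w
    simp only [PiLp.inner_apply, Fintype.sum_prod_type, s]
    rw [Finset.sum_comm]
  have hs : ∀ p v, s p (Matrix.toEuclideanLin (A ⊗ₖ (1 : Matrix τ τ ℂ)) v) =
      Matrix.toEuclideanLin A (s p v) := by
    intro p v
    ext x
    simp [s, Matrix.mulVec, dotProduct, Fintype.sum_prod_type, Matrix.one_apply]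
  constructor
  · intro v w
    rw [hinner, hinner]
    exact Finset.sum_congr rfl fun p _ => by rw [hs, hs, hA.symm]
  · intro v
    refine (sq_le_sq₀ (norm_nonneg _) (norm_nonneg _)).1 ?_
    rw [← inner_self_eq_norm_sq (𝕜 := ℂ), ← inner_self_eq_norm_sq (𝕜 := ℂ), hinner, hinner,
      map_sum, map_sum]
    refine Finset.sum_le_sum fun p _ => ?_
    rw [hs, inner_self_eq_norm_sq, inner_self_eq_norm_sq]
    exact pow_le_pow_left₀ (norm_nonneg _) (hA.norm_le _) 2

end Ancilla

/-! ### Success probabilities as correlations -/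

section Correlations

theorem expect_pBasis (f : PBasis → ℝ) : 𝔼 N, f N = (f PBasis.X + f PBasis.Z) / 2 := by
  rw [Fintype.expect_eq_sum_div_card, show (Finset.univ : Finset PBasis) = {PBasis.X, PBasis.Z} from
    rfl, Finset.sum_pair (by decide), show Fintype.card PBasis = 2 from rfl]
  norm_num

instance : Nonempty PBasis := ⟨PBasis.X⟩

theorem label_label {n : ℕ} (a b : Str n) (x : ℤˣ × ℤˣ) : label a b (label a b x) = x := by
  unfold label
  split_ifs <;> rfl

theorem expect_rotate {α β γ : Type*} [Fintype α] [Fintype β] [Fintype γ] (f : α → β → γ → ℝ) :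
    𝔼 a, 𝔼 b, 𝔼 c, f a b c = 𝔼 c, 𝔼 a, 𝔼 b, f a b c := by
  rw [Finset.expect_congr rfl fun a _ => Finset.expect_comm _ _ _, Finset.expect_comm]

variable {r n : ℕ} {ι : Fin r → Type*} [∀ j, Fintype (ι j)] [∀ j, DecidableEq (ι j)]

namespace Strategy

/-- The observable of prover `j` for a sign that is computed from the answer to the query `q`. -/
noncomputable def signObs (P : Strategy r n ι) (j : Fin r) (q : Query n)
    (f : ℤˣ × ℤˣ → ℤˣ) : Matrix (ι j) (ι j) ℂ :=
  signedSum f (P.meas j q)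

/-- The observables of the answer to `a`, the answer to `b` and their product on the query
`(N, a, b)`. -/
noncomputable def marginal (P : Strategy r n ι) (j : Fin r) (N : PBasis) (t : Fin 3)
    (a b : Str n) : Matrix (ι j) (ι j) ℂ :=
  P.signObs j (Query.pauli N (sortPair a b)) fun x =>
    ![(label a b x).1, (label a b x).2, (label a b x).1 * (label a b x).2] t

/-- The observable of the composite answer to `u`, for given padding `c`. -/
noncomputable def compositeOp (P : Strategy r n ι) (s : Fin r → ZMod 2) (i : Fin r) (N : PBasis)
    (u c : Str n) : Matrix (∀ j, ι j) (∀ j, ι j) ℂ :=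
  tensorOp fun j => if j = i then 1 else if s j = 1 then
    P.signObs j (Query.pauli N (sortPair u c)) (fun x => (label u c x).1) else 1

/-- The observable of the composite answer to `u`. -/
noncomputable def compositeObs (P : Strategy r n ι) (s : Fin r → ZMod 2) (i : Fin r) (N : PBasis)
    (u : Str n) : Matrix (∀ j, ι j) (∀ j, ι j) ℂ :=
  ((1 : ℂ) / 2 ^ n) • ∑ c, P.compositeOp s i N u c

/-- Correlation of the special and the composite prover in the linearity test. -/
noncomputable def linCorr (P : Strategy r n ι) (s : Fin r → ZMod 2) (i : Fin r) (N : PBasis)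
    (t : Fin 3) (a b : Str n) : ℝ :=
  (inner ℂ (Matrix.toEuclideanLin (localOp i (P.marginal i N t a b)) P.state)
    (Matrix.toEuclideanLin (P.compositeObs s i N (![a, b, a + b] t)) P.state)).re

/-- Correlation of the special and the composite prover in the anticommutation test. -/
noncomputable def rotCorr (P : Strategy r n ι) (s : Fin r → ZMod 2) (i : Fin r) (N' N : PBasis)
    (a b : Str n) : ℝ :=
  (inner ℂ (Matrix.toEuclideanLin (localOp i (P.signObs i (Query.rot N' a b) Prod.fst)) P.state)
    (Matrix.toEuclideanLin (P.compositeObs s i N (if N = PBasis.X then a else b)) P.state)).re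

/-- The CHSH expression of the anticommutation test. -/
noncomputable def chsh (P : Strategy r n ι) (s : Fin r → ZMod 2) (i : Fin r) (a b : Str n) : ℝ :=
  P.rotCorr s i PBasis.X PBasis.X a b + P.rotCorr s i PBasis.X PBasis.Z a b
    + P.rotCorr s i PBasis.Z PBasis.X a b - P.rotCorr s i PBasis.Z PBasis.Z a b

variable (P : Strategy r n ι) (s : Fin r → ZMod 2) (i : Fin r)

theorem isSymmContraction_localOp_signObs (q : Query n) (f : ℤˣ × ℤˣ → ℤˣ) :
    IsSymmContraction (Matrix.toEuclideanLin (localOp i (P.signObs i q f))) := by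
  rw [signObs, localOp_signedSum]
  exact ((P.isPOVM i q).localOp i).isSymmContraction_signedSum f

theorem isSymmContraction_tensorOp_signObs (q : Fin r → Query n)
    (f : Fin r → ℤˣ × ℤˣ → ℤˣ) :
    IsSymmContraction (Matrix.toEuclideanLin (tensorOp fun j => P.signObs j (q j) (f j))) := by
  simp only [signObs]
  rw [tensorOp_signedSum]
  exact (IsPOVM.tensorOp fun j => P.isPOVM j (q j)).isSymmContraction_signedSum _

theorem signObs_one (j : Fin r) (q : Query n) : P.signObs j q 1 = 1 :=
  signedSum_one (P.isPOVM j q)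

theorem isSymmContraction_compositeOp (N : PBasis) (u c : Str n) :
    IsSymmContraction (Matrix.toEuclideanLin (P.compositeOp s i N u c)) := by
  -- An identity factor is the signed sum of any POVM with all signs `+1`, so the whole product is a
  -- signed sum of one product POVM.
  have h : P.compositeOp s i N u c = tensorOp fun j => P.signObs j (Query.pauli N (sortPair u c))
      (if j = i then 1 else if s j = 1 then fun x => (label u c x).1 else 1) := by
    unfold compositeOp
    congr 1
    funext j
    split_ifs <;> simp only [signObs_one]
  rw [h]
  exact P.isSymmContraction_tensorOp_signObs _ _

theorem isSymmContraction_compositeObs (N : PBasis) (u : Str n) :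
    IsSymmContraction (Matrix.toEuclideanLin (P.compositeObs s i N u)) := by
  rw [compositeObs, map_smul, map_sum]
  exact isSymmContraction_average fun c => P.isSymmContraction_compositeOp s i N u c

theorem localOp_mul_compositeOp (A : Matrix (ι i) (ι i) ℂ) (N : PBasis) (u c : Str n) :
    localOp i A * P.compositeOp s i N u c = P.compositeOp s i N u c * localOp i A := by
  rw [compositeOp, localOp_mul_tensorOp _ _ (if_pos rfl), tensorOp_mul_localOp _ _ (if_pos rfl)]

theorem localOp_compositeObs_comm (A : Matrix (ι i) (ι i) ℂ) (N : PBasis) (u : Str n)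
    (v : EuclideanSpace ℂ (∀ j, ι j)) :
    Matrix.toEuclideanLin (localOp i A) (Matrix.toEuclideanLin (P.compositeObs s i N u) v) =
      Matrix.toEuclideanLin (P.compositeObs s i N u) (Matrix.toEuclideanLin (localOp i A) v) := by
  rw [← toEuclideanLin_mul_apply, ← toEuclideanLin_mul_apply]
  congr 2
  simp only [compositeObs, Matrix.mul_smul, Matrix.smul_mul, Finset.mul_sum, Finset.sum_mul,
    localOp_mul_compositeOp]

theorem sum_prob (q : Fin r → Query n) : ∑ x, P.prob q x = 1 := by
  unfold prob opApply
  rw [← Complex.re_sum, ← inner_sum, ← LinearMap.sum_apply, ← map_sum,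
    (IsPOVM.tensorOp fun j => P.isPOVM j (q j)).2, toEuclideanLin_one_apply,
    ← RCLike.re_eq_complex_re, inner_self_eq_norm_sq, P.norm_state, one_pow]

theorem acceptProb_of_forall (q : Fin r → Query n) {acc : (Fin r → ℤˣ × ℤˣ) → Prop}
    (h : ∀ x, acc x) : P.acceptProb q acc = 1 := by
  rw [← P.sum_prob q, acceptProb]
  exact Finset.sum_congr rfl fun x _ => if_pos (h x)

/-- The indicator of `σ = 1` for a sign `σ` is `(1 + σ)/2`, and the probabilities sum to `1`. -/
theorem acceptProb_prod_eq_one (q : Fin r → Query n) (f : Fin r → ℤˣ × ℤˣ → ℤˣ) :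
    P.acceptProb q (fun x => ∏ j, f j (x j) = 1) =
      (1 + (inner ℂ P.state (Matrix.toEuclideanLin
        (tensorOp fun j => P.signObs j (q j) (f j)) P.state)).re) / 2 := by
  have h1 : (inner ℂ P.state (Matrix.toEuclideanLin
        (tensorOp fun j => P.signObs j (q j) (f j)) P.state)).re =
      ∑ x, (((∏ j, f j (x j) : ℤˣ) : ℤ) : ℝ) * P.prob q x := by
    simp only [signObs]
    rw [tensorOp_signedSum, signedSum, map_sum, LinearMap.sum_apply, inner_sum, Complex.re_sum]
    refine Finset.sum_congr rfl fun x _ => ?_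
    rw [map_smul, LinearMap.smul_apply, inner_smul_right,
      show (((∏ j, f j (x j) : ℤˣ) : ℤ) : ℂ) = ((((∏ j, f j (x j) : ℤˣ) : ℤ) : ℝ) : ℂ) by simp,
      Complex.re_ofReal_mul]
    rfl
  rw [h1, acceptProb]
  conv_rhs => rw [← P.sum_prob q]
  rw [← Finset.sum_add_distrib, Finset.sum_div]
  refine Finset.sum_congr rfl fun x _ => ?_
  rcases Int.units_eq_one_or (∏ j, f j (x j)) with h | h
  · rw [h, if_pos rfl]; push_cast; ring
  · rw [h, if_neg (by decide)]; push_cast; ring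

/-- Provers sent the unrelated strings `d` contribute the sign `1`, hence the identity operator, so
`d` drops out. -/
theorem acceptProb_roundQuery (Q : Query n) (N : PBasis) (u c : Str n)
    (d : Fin r → Str n × Str n) (g : ℤˣ × ℤˣ → ℤˣ) :
    P.acceptProb (roundQuery s i Q N u c d)
        (fun x => g (x i) * compositeAnswer s i u c x = 1) =
      (1 + (inner ℂ (Matrix.toEuclideanLin (localOp i (P.signObs i Q g)) P.state)
        (Matrix.toEuclideanLin (P.compositeOp s i N u c) P.state)).re) / 2 := by
  let f : Fin r → ℤˣ × ℤˣ → ℤˣ := fun j => if j = i then g else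
    if s j = 1 then fun x => (label u c x).1 else 1
  have h1 : (fun x : Fin r → ℤˣ × ℤˣ => g (x i) * compositeAnswer s i u c x = 1) =
      fun x => ∏ j, f j (x j) = 1 := by
    funext x
    have : ∀ j, f j (x j) = (if j = i then g (x j) else 1) *
        (if j ≠ i ∧ s j = 1 then (label u c (x j)).1 else 1) := by
      intro j
      by_cases h1 : j = i <;> by_cases h2 : s j = 1 <;> simp [f, h1, h2]
    simp only [this, Finset.prod_mul_distrib, Finset.prod_ite_eq', Finset.mem_univ, if_true,
      compositeAnswer]
  have h2 : (tensorOp fun j => P.signObs j (roundQuery s i Q N u c d j) (f j)) =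
      localOp i (P.signObs i Q g) * P.compositeOp s i N u c := by
    rw [compositeOp, localOp_mul_tensorOp _ _ (if_pos rfl)]
    congr 1
    funext j
    rcases eq_or_ne j i with rfl | hj
    · simp [f, roundQuery]
    · by_cases h2 : s j = 1
      · simp [f, roundQuery, hj, h2, Function.update_of_ne]
      · simp [f, hj, h2, Function.update_of_ne, signObs_one]
  rw [h1, acceptProb_prod_eq_one, h2, toEuclideanLin_mul_apply,
    ← (P.isSymmContraction_localOp_signObs i Q g).symm]

theorem expect_acceptProb_roundQuery (Q : Query n) (N : PBasis) (u : Str n)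
    (g : ℤˣ × ℤˣ → ℤˣ) :
    𝔼 c : Str n, 𝔼 d : Fin r → Str n × Str n, P.acceptProb (roundQuery s i Q N u c d)
        (fun x => g (x i) * compositeAnswer s i u c x = 1) =
      (1 + (inner ℂ (Matrix.toEuclideanLin (localOp i (P.signObs i Q g)) P.state)
        (Matrix.toEuclideanLin (P.compositeObs s i N u) P.state)).re) / 2 := by
  simp only [acceptProb_roundQuery, Fintype.expect_const]
  rw [compositeObs, map_smul, map_sum, LinearMap.smul_apply, LinearMap.sum_apply, re_inner_average,
    ← Finset.expect_div, Finset.expect_add_distrib, Fintype.expect_const]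

theorem units_eq_iff_mul_eq_one (x y : ℤˣ) : x = y ↔ y * x = 1 := by
  rw [mul_eq_one_iff_eq_inv, Int.units_inv_eq_self, eq_comm]

theorem linearityProb_eq :
    P.linearityProb s i = 𝔼 N, 𝔼 a, 𝔼 b, 𝔼 t, (1 + P.linCorr s i N t a b) / 2 := by
  unfold linearityProb
  refine Finset.expect_congr rfl fun N _ => Finset.expect_congr rfl fun a _ =>
    Finset.expect_congr rfl fun b _ => ?_
  refine (expect_rotate _).trans (Finset.expect_congr rfl fun t _ => ?_)
  refine Eq.trans (Finset.expect_congr rfl fun c _ => Finset.expect_congr rfl fun d _ => ?_)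
    (P.expect_acceptProb_roundQuery s i (Query.pauli N (sortPair a b)) N (![a, b, a + b] t)
      fun x => ![(label a b x).1, (label a b x).2, (label a b x).1 * (label a b x).2] t)
  exact congrArg _ (funext fun x => propext (units_eq_iff_mul_eq_one _ _))

theorem stabilizerProb_eq :
    P.stabilizerProb s i = 𝔼 N, 𝔼 a, 𝔼 b, (1 + P.linCorr s i N 0 a b) / 2 := by
  unfold stabilizerProb
  refine Finset.expect_congr rfl fun N _ => Finset.expect_congr rfl fun a _ =>
    Finset.expect_congr rfl fun b _ => ?_
  exact P.expect_acceptProb_roundQuery s i _ N a fun x => (label a b x).1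

theorem str_zmod_ne_zero (z : ZMod 2) : z ≠ 0 ↔ z = 1 := by
  revert z; decide

/-- Each setting contributes `(1 ± rotCorr)/2`, with the minus sign only for `(Z', Z)`; averaging
over the four settings gives `1/2 + chsh/8`. -/
theorem anticommutationProb_eq :
    P.anticommutationProb s i =
      𝔼 a, 𝔼 b, if a ⬝ᵥ b = 0 then 1 else 1 / 2 + P.chsh s i a b / 8 := by
  have key : ∀ N N' a b, (𝔼 c : Str n, 𝔼 d : Fin r → Str n × Str n, P.acceptProb
      (roundQuery s i (Query.rot N' a b) N (if N = PBasis.X then a else b) c d)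
      (fun ans => a ⬝ᵥ b = 0 ∨
        (ans i).1 * compositeAnswer s i (if N = PBasis.X then a else b) c ans =
          if N' = PBasis.Z ∧ N = PBasis.Z then -1 else 1)) =
      if a ⬝ᵥ b = 0 then 1 else
        (1 + (if N' = PBasis.Z ∧ N = PBasis.Z then -1 else 1) * P.rotCorr s i N' N a b) / 2 := by
    intro N N' a b
    by_cases hab : a ⬝ᵥ b = 0
    · simp only [hab, true_or, if_true]
      rw [Finset.expect_congr rfl fun c _ => Finset.expect_congr rfl fun d _ =>
        P.acceptProb_of_forall _ fun _ => trivial]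
      simp only [Fintype.expect_const]
    · simp only [hab, false_or, if_false]
      by_cases hN : N' = PBasis.Z ∧ N = PBasis.Z
      · simp only [hN, and_self, if_true]
        -- The required sign `-1` is absorbed into the special prover's answer, which negates its
        -- observable.
        have h : ∀ (x : ℤˣ × ℤˣ) (y : ℤˣ), (x.1 * y = -1) = ((fun x => -x.1) x * y = 1) := by
          intro x y
          simp only [neg_mul, neg_eq_iff_eq_neg]
        simp only [h]
        refine (P.expect_acceptProb_roundQuery s i (Query.rot PBasis.Z a b) PBasis.Z _
          fun x => -x.1).trans ?_
        have h2 : P.signObs i (Query.rot PBasis.Z a b) (fun x => -x.1) =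
            -P.signObs i (Query.rot PBasis.Z a b) Prod.fst := by
          simp [signObs, signedSum]
        rw [h2, map_neg, map_neg, LinearMap.neg_apply, inner_neg_left, Complex.neg_re, neg_one_mul]
        rfl
      · simp only [hN, if_false, one_mul]
        exact P.expect_acceptProb_roundQuery s i (Query.rot N' a b) N _ Prod.fst
  unfold anticommutationProb
  simp only [key]
  simp only [expect_pBasis, Finset.expect_div, ← Finset.expect_add_distrib]
  refine Finset.expect_congr rfl fun a _ => Finset.expect_congr rfl fun b _ => ?_
  by_cases hab : a ⬝ᵥ b = 0
  · simp only [hab, if_true]; norm_num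
  · simp only [hab, if_false, chsh, reduceCtorEq, and_self, and_false, false_and, if_true]
    ring

theorem sum_label (j : Fin r) (N : PBasis) (a b : Str n) (f : ℤˣ × ℤˣ → ℤˣ) :
    P.signObs j (Query.pauli N (sortPair a b)) (fun x => f (label a b x)) =
      ∑ α, ∑ β, ((f (α, β) : ℤ) : ℂ) • P.pauliOp j N a b α β := by
  rw [← Fintype.sum_prod_type' fun α β => ((f (α, β) : ℤ) : ℂ) • P.pauliOp j N a b α β]
  have hinv : Function.Involutive (label a b) := label_label a b
  unfold signObs signedSum
  exact Fintype.sum_equiv hinv.toPerm _ _ fun x => by simp [pauliOp, label_label]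

theorem hatX_eq (j : Fin r) (a : Str n) :
    P.hatX j a = ((1 : ℂ) / 2 ^ n) • ∑ b, P.marginal j PBasis.X 0 a b := by
  unfold hatX marginal
  congr 1
  refine Finset.sum_congr rfl fun b _ => ?_
  have := P.sum_label j PBasis.X a b Prod.fst
  refine Eq.trans ?_ this.symm
  rw [sum_units_int (fun α : ℤˣ => ∑ β, ((α : ℤ) : ℂ) • P.pauliOp j PBasis.X a b α β)]
  simp only [sum_units_int, Units.val_one, Units.val_neg, Int.cast_one, Int.cast_neg, one_smul,
    neg_smul]
  abel

theorem hatZ_eq (j : Fin r) (b : Str n) :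
    P.hatZ j b = ((1 : ℂ) / 2 ^ n) • ∑ a, P.marginal j PBasis.Z 1 a b := by
  unfold hatZ marginal
  congr 1
  refine Finset.sum_congr rfl fun a _ => ?_
  have := P.sum_label j PBasis.Z a b Prod.snd
  refine Eq.trans ?_ this.symm
  refine Finset.sum_congr rfl fun α _ => ?_
  rw [sum_units_int (fun β : ℤˣ => ((β : ℤ) : ℂ) • P.pauliOp j PBasis.Z a b α β)]
  simp [sub_eq_add_neg]

theorem linCorr_le_one (N : PBasis) (t : Fin 3) (a b : Str n) : P.linCorr s i N t a b ≤ 1 := by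
  refine (abs_le.1 (abs_re_inner_le_norm _ _)).2.trans ?_
  have h1 := (P.isSymmContraction_localOp_signObs i (Query.pauli N (sortPair a b)) fun x =>
    ![(label a b x).1, (label a b x).2, (label a b x).1 * (label a b x).2] t).norm_le P.state
  have h2 := (P.isSymmContraction_compositeObs s i N (![a, b, a + b] t)).norm_le P.state
  rw [P.norm_state] at h1 h2
  exact mul_le_one₀ h1 (norm_nonneg _) h2

theorem linearityProb_le_one : P.linearityProb s i ≤ 1 := by
  rw [linearityProb_eq]
  refine Finset.expect_le Finset.univ_nonempty fun N _ =>
    Finset.expect_le Finset.univ_nonempty fun a _ => Finset.expect_le Finset.univ_nonempty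
    fun b _ => Finset.expect_le Finset.univ_nonempty fun t _ => ?_
  linarith [P.linCorr_le_one s i N t a b]

theorem stabilizerProb_le_one : P.stabilizerProb s i ≤ 1 := by
  rw [stabilizerProb_eq]
  refine Finset.expect_le Finset.univ_nonempty fun N _ =>
    Finset.expect_le Finset.univ_nonempty fun a _ => Finset.expect_le Finset.univ_nonempty
    fun b _ => ?_
  linarith [P.linCorr_le_one s i N 0 a b]

/-- In `tsirelson_rigidity` the composite observables play `A` and `C`, and the special prover's
answers to the `X'`- and `Z'`-queries play `V` and `W`. So it is the composite observables that are
shown to anticommute. -/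
theorem anticommutator_sq_le (a b : Str n) :
    ‖Matrix.toEuclideanLin (P.compositeObs s i PBasis.X a)
        (Matrix.toEuclideanLin (P.compositeObs s i PBasis.Z b) P.state)
      + Matrix.toEuclideanLin (P.compositeObs s i PBasis.Z b)
        (Matrix.toEuclideanLin (P.compositeObs s i PBasis.X a) P.state)‖ ^ 2
      ≤ 100 * (2 * √2 - P.chsh s i a b) :=
  tsirelson_rigidity (P.isSymmContraction_compositeObs s i PBasis.X a)
    (P.isSymmContraction_compositeObs s i PBasis.Z b)
    (P.isSymmContraction_localOp_signObs i (Query.rot PBasis.X a b) Prod.fst)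
    (P.isSymmContraction_localOp_signObs i (Query.rot PBasis.Z a b) Prod.fst)
    (P.localOp_compositeObs_comm s i _ _ _) (P.localOp_compositeObs_comm s i _ _ _)
    (P.localOp_compositeObs_comm s i _ _ _) (P.localOp_compositeObs_comm s i _ _ _) P.norm_state

/-- Tsirelson's bound follows because the rigidity estimate bounds a square from above. -/
theorem chsh_le (a b : Str n) : P.chsh s i a b ≤ 2 * √2 := by
  have h := P.anticommutator_sq_le s i a b
  nlinarith [sq_nonneg ‖Matrix.toEuclideanLin (P.compositeObs s i PBasis.X a)
        (Matrix.toEuclideanLin (P.compositeObs s i PBasis.Z b) P.state)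
      + Matrix.toEuclideanLin (P.compositeObs s i PBasis.Z b)
        (Matrix.toEuclideanLin (P.compositeObs s i PBasis.X a) P.state)‖]

theorem anticommutationProb_le :
    P.anticommutationProb s i ≤
      𝔼 a : Str n, 𝔼 b : Str n, if a ⬝ᵥ b = 0 then 1 else 1 / 2 + √2 / 4 := by
  rw [anticommutationProb_eq]
  refine expect_mono fun a => expect_mono fun b => ?_
  split_ifs
  · rfl
  · linarith [P.chsh_le s i a b]

end Strategy

end Correlations

/-! ### The value of the honest strategy -/

section Honest

theorem pauliString_mul {n : ℕ} (N : PBasis) (a b : Str n) :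
    pauliString N a * pauliString N b = pauliString N (a + b) := by
  have hz : ∀ z : ZMod 2, z = 0 ∨ z = 1 := by decide
  unfold pauliString
  rw [tensorOp_mul]
  congr 1
  funext k
  rcases hz (a k) with h1 | h1 <;> rcases hz (b k) with h2 | h2 <;>
    simp [h1, h2, pauliMat_mul_self, CharTwo.add_self_eq_zero]

theorem pauliString_zero {n : ℕ} (N : PBasis) : pauliString N (0 : Str n) = 1 := by
  unfold pauliString
  rw [← tensorOp_one]
  congr 1

theorem eigProj_sub {ι : Type*} [DecidableEq ι] (O : Matrix ι ι ℂ) :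
    eigProj 1 O - eigProj (-1) O = O := by
  unfold eigProj
  simp only [Units.val_one, Units.val_neg, Int.cast_one, Int.cast_neg]
  module

variable {r n : ℕ}

theorem honest_signObs_fst (φ : EuclideanSpace ℂ (Fin r → Fin n → Fin 2)) (hφ : ‖φ‖ = 1)
    (j : Fin r) (N : PBasis) (p : Str n × Str n) :
    (honestStrategy φ hφ).signObs j (Query.pauli N p) Prod.fst = pauliString N p.1 := by
  have h1 := eigProj_sub (pauliString N p.1)
  have h2 := eigProj_sum (pauliString N p.2)
  simp only [Strategy.signObs, signedSum, honestStrategy, honestMeas, Fintype.sum_prod_type,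
    sum_units_int, Units.val_one, Units.val_neg, Int.cast_one, Int.cast_neg, one_smul, neg_smul]
  conv_rhs => rw [← mul_one (pauliString N p.1), ← h2, ← h1]
  noncomm_ring

theorem honest_signObs_snd (φ : EuclideanSpace ℂ (Fin r → Fin n → Fin 2)) (hφ : ‖φ‖ = 1)
    (j : Fin r) (N : PBasis) (p : Str n × Str n) :
    (honestStrategy φ hφ).signObs j (Query.pauli N p) Prod.snd = pauliString N p.2 := by
  have h1 := eigProj_sum (pauliString N p.1)
  have h2 := eigProj_sub (pauliString N p.2)
  simp only [Strategy.signObs, signedSum, honestStrategy, honestMeas, Fintype.sum_prod_type,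
    sum_units_int, Units.val_one, Units.val_neg, Int.cast_one, Int.cast_neg, one_smul, neg_smul]
  conv_rhs => rw [← one_mul (pauliString N p.2), ← h1, ← h2]
  noncomm_ring

theorem honest_signObs_mul (φ : EuclideanSpace ℂ (Fin r → Fin n → Fin 2)) (hφ : ‖φ‖ = 1)
    (j : Fin r) (N : PBasis) (p : Str n × Str n) :
    (honestStrategy φ hφ).signObs j (Query.pauli N p) (fun x => x.1 * x.2) =
      pauliString N (p.1 + p.2) := by
  have h1 := eigProj_sub (pauliString N p.1)
  have h2 := eigProj_sub (pauliString N p.2)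
  simp only [Strategy.signObs, signedSum, honestStrategy, honestMeas, Fintype.sum_prod_type,
    sum_units_int, Units.val_one, Units.val_neg, Int.cast_one, Int.cast_neg, one_smul, neg_smul,
    mul_one, mul_neg, neg_neg]
  rw [← pauliString_mul]
  conv_rhs => rw [← h1, ← h2]
  noncomm_ring

theorem honest_signObs_rot (φ : EuclideanSpace ℂ (Fin r → Fin n → Fin 2)) (hφ : ‖φ‖ = 1)
    (j : Fin r) (N : PBasis) {a b : Str n} (h : a ⬝ᵥ b = 1) :
    (honestStrategy φ hφ).signObs j (Query.rot N a b) Prod.fst = rotObs N a b := by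
  have h1 := eigProj_sub (rotObs N a b)
  have hne : ¬ ((-1 : ℤˣ) = 1) := by decide
  simp only [Strategy.signObs, signedSum, honestStrategy, honestMeas, Fintype.sum_prod_type,
    sum_units_int, Units.val_one, Units.val_neg, Int.cast_one, Int.cast_neg, one_smul, neg_smul,
    h, hne, if_true, if_false, neg_zero, add_zero]
  rw [← sub_eq_add_neg, h1]

theorem honest_marginal (φ : EuclideanSpace ℂ (Fin r → Fin n → Fin 2)) (hφ : ‖φ‖ = 1)
    (j : Fin r) (N : PBasis) (t : Fin 3) (a b : Str n) :
    (honestStrategy φ hφ).marginal j N t a b = pauliString N (![a, b, a + b] t) := by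
  unfold Strategy.marginal sortPair label
  by_cases h : lexLE a b
  · simp only [h, if_true]
    fin_cases t
    · exact honest_signObs_fst φ hφ j N (a, b)
    · exact honest_signObs_snd φ hφ j N (a, b)
    · exact honest_signObs_mul φ hφ j N (a, b)
  · simp only [h, if_false]
    fin_cases t
    · exact honest_signObs_snd φ hφ j N (b, a)
    · exact honest_signObs_fst φ hφ j N (b, a)
    · have := honest_signObs_mul φ hφ j N (b, a)
      simp only [add_comm] at this
      simpa [mul_comm, add_comm] using this

variable {C : CSSCode r} {φ : EuclideanSpace ℂ (Fin r → Fin n → Fin 2)}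

/-- The operator is the product, over the positions `k` with `u k = 1`, of the stabilizers acting on
the `k`-th qubits of all provers. -/
theorem stabilizer_apply {s : Fin r → ZMod 2} {N : PBasis}
    (h : ∀ k : Fin n, Matrix.toEuclideanLin
      (tensorOp fun j => pauliString N (Pi.single k (s j) : Str n)) φ = φ) (u : Str n) :
    Matrix.toEuclideanLin (tensorOp fun j => if s j = 1 then pauliString N u else 1) φ = φ := by
  have hz : ∀ z : ZMod 2, z = 0 ∨ z = 1 := by decide
  have key : ∀ t : Finset (Fin n), Matrix.toEuclideanLin
      (tensorOp fun j => pauliString N (∑ k ∈ t, Pi.single k (u k * s j) : Str n)) φ = φ := by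
    intro t
    induction t using Finset.induction_on with
    | empty =>
      simp only [Finset.sum_empty, pauliString_zero, tensorOp_one, toEuclideanLin_one_apply]
    | insert k t hk ih =>
      simp only [Finset.sum_insert hk, ← pauliString_mul]
      rw [← tensorOp_mul, toEuclideanLin_mul_apply, ih]
      rcases hz (u k) with h1 | h1
      · simp only [h1, zero_mul, Pi.single_zero, pauliString_zero, tensorOp_one,
          toEuclideanLin_one_apply]
      · simp only [h1, one_mul, h]
  have := key Finset.univ
  simp only [Finset.univ_sum_single] at this
  have e : (fun j => if s j = 1 then pauliString N u else 1) =
      fun j => pauliString N fun k => u k * s j := by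
    funext j
    rcases hz (s j) with h1 | h1
    · simp only [h1, mul_zero, zero_ne_one, if_false]
      exact (pauliString_zero N).symm
    · simp [h1]
  rw [e]
  exact this

theorem CSSCode.IsEncoded.stabilizer_apply (hφ : C.IsEncoded φ) {s : Fin r → ZMod 2}
    (hx : s ∈ C.xStab) (hz : s ∈ C.zStab) (N : PBasis) (u : Str n) :
    Matrix.toEuclideanLin (tensorOp fun j => if s j = 1 then pauliString N u else 1) φ = φ :=
  match N with
  | PBasis.X => _root_.stabilizer_apply (fun k => (hφ.2 k).1 s hx) u
  | PBasis.Z => _root_.stabilizer_apply (fun k => (hφ.2 k).2 s hz) u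

theorem localOp_observable_apply_apply {i : Fin r} {O : Matrix (Fin n → Fin 2) (Fin n → Fin 2) ℂ}
    (hO : IsObservable O) (v : EuclideanSpace ℂ (Fin r → Fin n → Fin 2)) :
    Matrix.toEuclideanLin (localOp (ι := fun _ => Fin n → Fin 2) i O)
      (Matrix.toEuclideanLin (localOp (ι := fun _ => Fin n → Fin 2) i O) v) = v := by
  rw [← toEuclideanLin_mul_apply, ← map_mul, hO.2, map_one, toEuclideanLin_one_apply]

/-- `N(u)` on prover `i` times the composite operator is the transversal stabilizer, which fixes
`φ`; `N(u)` is its own inverse. The padding `c` does not matter. -/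
theorem honest_compositeObs_apply (hφ : C.IsEncoded φ) {s : Fin r → ZMod 2}
    (hx : s ∈ C.xStab) (hz : s ∈ C.zStab) {i : Fin r} (hi : s i = 1) (N : PBasis) (u : Str n) :
    Matrix.toEuclideanLin ((honestStrategy φ hφ.1).compositeObs s i N u) φ =
      Matrix.toEuclideanLin (localOp (ι := fun _ => Fin n → Fin 2) i (pauliString N u)) φ := by
  have h1 : ∀ c, Matrix.toEuclideanLin ((honestStrategy φ hφ.1).compositeOp s i N u c) φ =
      Matrix.toEuclideanLin (localOp (ι := fun _ => Fin n → Fin 2) i (pauliString N u)) φ := by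
    intro c
    conv_lhs => rw [← localOp_observable_apply_apply (i := i) (pauliString_isObservable N u)
      (Matrix.toEuclideanLin ((honestStrategy φ hφ.1).compositeOp s i N u c) φ)]
    congr 1
    rw [← toEuclideanLin_mul_apply]
    conv_rhs => rw [← hφ.stabilizer_apply hx hz N u]
    congr 2
    unfold Strategy.compositeOp
    rw [localOp_mul_tensorOp _ _ (if_pos rfl)]
    congr 1
    funext j
    rcases eq_or_ne j i with rfl | hj
    · simp [hi]
    · simp only [Function.update_of_ne hj, hj, if_false]
      have := honest_marginal φ hφ.1 j N 0 u c
      split_ifs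
      · exact this
      · rfl
  rw [Strategy.compositeObs, map_smul, map_sum, LinearMap.smul_apply, LinearMap.sum_apply]
  simp only [h1]
  rw [Finset.sum_const, Finset.card_univ, Fintype.card_fun, ZMod.card, Fintype.card_fin,
    ← Nat.cast_smul_eq_nsmul ℂ, smul_smul]
  push_cast
  rw [one_div_mul_cancel (by positivity), one_smul]

theorem re_inner_localOp_self (hφ : ‖φ‖ = 1) (i : Fin r)
    {O : Matrix (Fin n → Fin 2) (Fin n → Fin 2) ℂ} (hO : IsObservable O) :
    (inner ℂ (Matrix.toEuclideanLin (localOp (ι := fun _ => Fin n → Fin 2) i O) φ)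
      (Matrix.toEuclideanLin (localOp (ι := fun _ => Fin n → Fin 2) i O) φ)).re = 1 := by
  have hs : (localOp (ι := fun _ => Fin n → Fin 2) i O)ᴴ = localOp i O := by
    rw [localOp_def, tensorOp_conjTranspose]
    congr 1
    funext j
    rcases eq_or_ne j i with rfl | hj
    · rw [Function.update_self]
      exact hO.1
    · simp [Function.update_of_ne hj]
  rw [inner_toEuclideanLin_left, hs, localOp_observable_apply_apply hO, ← RCLike.re_eq_complex_re,
    inner_self_eq_norm_sq, hφ, one_pow]

theorem honest_linCorr (hφ : C.IsEncoded φ) {s : Fin r → ZMod 2}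
    (hx : s ∈ C.xStab) (hz : s ∈ C.zStab) {i : Fin r} (hi : s i = 1) (N : PBasis) (t : Fin 3)
    (a b : Str n) : (honestStrategy φ hφ.1).linCorr s i N t a b = 1 := by
  unfold Strategy.linCorr
  rw [honest_marginal]
  have h := honest_compositeObs_apply hφ hx hz hi N (![a, b, a + b] t)
  refine Eq.trans ?_ (re_inner_localOp_self hφ.1 i (pauliString_isObservable N (![a, b, a + b] t)))
  exact congrArg (fun v => (inner ℂ _ v).re) h

/-- The composite observables act on `φ` as `X(a)` and `Z(b)` on prover `i`, and `X(a) ± Z(b)` is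
`√2` times the rotated observable. Each rotated query therefore contributes `√2`. -/
theorem honest_chsh (hφ : C.IsEncoded φ) {s : Fin r → ZMod 2}
    (hx : s ∈ C.xStab) (hz : s ∈ C.zStab) {i : Fin r} (hi : s i = 1) {a b : Str n}
    (hab : a ⬝ᵥ b = 1) : (honestStrategy φ hφ.1).chsh s i a b = 2 * √2 := by
  let T : Matrix (Fin n → Fin 2) (Fin n → Fin 2) ℂ → EuclideanSpace ℂ (Fin r → Fin n → Fin 2) :=
    fun O => Matrix.toEuclideanLin (localOp (ι := fun _ => Fin n → Fin 2) i O) φ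
  have hr : ∀ N' N, (honestStrategy φ hφ.1).rotCorr s i N' N a b =
      (inner ℂ (T (rotObs N' a b)) (T (pauliString N (if N = PBasis.X then a else b)))).re := by
    intro N' N
    unfold Strategy.rotCorr
    rw [honest_signObs_rot φ hφ.1 i N' hab]
    exact congrArg (fun v => (inner ℂ _ v).re) (honest_compositeObs_apply hφ hx hz hi N _)
  have h2 : √2 * √2 = 2 := Real.mul_self_sqrt (by norm_num)
  have hs : ((√2 : ℝ) : ℂ) * (1 / ((√2 : ℝ) : ℂ)) = 1 := by
    rw [mul_one_div_cancel]
    exact_mod_cast (Real.sqrt_pos.2 (by norm_num : (0 : ℝ) < 2)).ne'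
  have e1 : T (pauliString PBasis.X a) + T (pauliString PBasis.Z b) =
      ((√2 : ℝ) : ℂ) • T (rotObs PBasis.X a b) := by
    simp only [T, rotObs, map_smul, map_add, LinearMap.add_apply, LinearMap.smul_apply, smul_smul,
      hs, if_true, one_smul]
  have e2 : T (pauliString PBasis.X a) - T (pauliString PBasis.Z b) =
      ((√2 : ℝ) : ℂ) • T (rotObs PBasis.Z a b) := by
    simp only [T, rotObs, map_smul, LinearMap.smul_apply, smul_smul, hs, reduceCtorEq, if_false,
      one_smul, neg_smul, ← sub_eq_add_neg]
    rw [map_sub, map_sub, LinearMap.sub_apply]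
  have f1 := re_inner_localOp_self hφ.1 i (rotObs_isObservable PBasis.X a b hab)
  have f2 := re_inner_localOp_self hφ.1 i (rotObs_isObservable PBasis.Z a b hab)
  have g1 : (inner ℂ (T (rotObs PBasis.X a b)) (T (pauliString PBasis.X a))).re
      + (inner ℂ (T (rotObs PBasis.X a b)) (T (pauliString PBasis.Z b))).re = √2 := by
    rw [← Complex.add_re, ← inner_add_right, e1, inner_smul_right, Complex.re_ofReal_mul]
    exact (congrArg (√2 * ·) f1).trans (mul_one _)
  have g2 : (inner ℂ (T (rotObs PBasis.Z a b)) (T (pauliString PBasis.X a))).re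
      - (inner ℂ (T (rotObs PBasis.Z a b)) (T (pauliString PBasis.Z b))).re = √2 := by
    rw [← Complex.sub_re, ← inner_sub_right, e2, inner_smul_right, Complex.re_ofReal_mul]
    exact (congrArg (√2 * ·) f2).trans (mul_one _)
  unfold Strategy.chsh
  simp only [hr, if_true, reduceCtorEq, if_false]
  linarith

/-- The success probability of the honest strategy in the anticommutation test. -/
noncomputable def anticommutationValue (n : ℕ) : ℝ :=
  𝔼 a : Str n, 𝔼 b : Str n, if a ⬝ᵥ b = 0 then 1 else 1 / 2 + √2 / 4

theorem honest_encodeProb (hφ : C.IsEncoded φ) {S : Fin r → Fin r → ZMod 2} (hS : C.IsChoice S)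
    (i₀ : Fin r) :
    (honestStrategy φ hφ.1).encodeProb S = (2 + anticommutationValue n) / 3 := by
  have : Nonempty (Fin r) := ⟨i₀⟩
  have h : ∀ i, ((honestStrategy φ hφ.1).linearityProb (S i) i
      + (honestStrategy φ hφ.1).anticommutationProb (S i) i
      + (honestStrategy φ hφ.1).stabilizerProb (S i) i) / 3 =
      (2 + anticommutationValue n) / 3 := by
    intro i
    obtain ⟨hx, hz, hi⟩ := hS i
    have h1 : (honestStrategy φ hφ.1).linearityProb (S i) i = 1 := by
      rw [Strategy.linearityProb_eq]
      simp only [honest_linCorr hφ hx hz hi, Fintype.expect_const]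
      norm_num
    have h2 : (honestStrategy φ hφ.1).stabilizerProb (S i) i = 1 := by
      rw [Strategy.stabilizerProb_eq]
      simp only [honest_linCorr hφ hx hz hi, Fintype.expect_const]
      norm_num
    have h3 : (honestStrategy φ hφ.1).anticommutationProb (S i) i = anticommutationValue n := by
      rw [Strategy.anticommutationProb_eq, anticommutationValue]
      refine Finset.expect_congr rfl fun a _ => Finset.expect_congr rfl fun b _ => ?_
      split_ifs with hab
      · rfl
      · rw [honest_chsh hφ hx hz hi ((Strategy.str_zmod_ne_zero _).1 hab)]
        ring
    rw [h1, h2, h3]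
    ring
  unfold Strategy.encodeProb
  simp only [h, Fintype.expect_const]

/-- A strategy whose success probability is within `ε` of the honest one loses at most `3rε` in each
test with each special prover. -/
theorem Strategy.tests_of_encodeProb (hφ : C.IsEncoded φ) {S : Fin r → Fin r → ZMod 2}
    (hS : C.IsChoice S) {ι : Fin r → Type*} [∀ j, Fintype (ι j)] [∀ j, DecidableEq (ι j)]
    (P : Strategy r n ι) {ε : ℝ} (h : (honestStrategy φ hφ.1).encodeProb S - ε ≤ P.encodeProb S)
    (i : Fin r) :
    1 - 3 * r * ε ≤ P.linearityProb (S i) i ∧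
      anticommutationValue n - 3 * r * ε ≤ P.anticommutationProb (S i) i := by
  rw [honest_encodeProb hφ hS i, Strategy.encodeProb, Fintype.expect_eq_sum_div_card,
    Fintype.card_fin] at h
  have hr : (0 : ℝ) < r := by exact_mod_cast i.pos
  rw [le_div_iff₀ hr, ← Finset.add_sum_erase _ _ (Finset.mem_univ i)] at h
  -- No special prover and no test can exceed the honest value, so one of them cannot make up for
  -- the loss of another; the weight `1/(3r)` of a single test gives `3rε`.
  have hle : ∀ j, (P.linearityProb (S j) j + P.anticommutationProb (S j) j
      + P.stabilizerProb (S j) j) / 3 ≤ (2 + anticommutationValue n) / 3 := by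
    intro j
    have := P.linearityProb_le_one (S j) j
    have := P.stabilizerProb_le_one (S j) j
    have : P.anticommutationProb (S j) j ≤ anticommutationValue n :=
      P.anticommutationProb_le (S j) j
    linarith
  have h2 := Finset.sum_le_sum fun j (_ : j ∈ Finset.univ.erase i) => hle j
  rw [Finset.sum_const, Finset.card_erase_of_mem (Finset.mem_univ i), Finset.card_univ,
    Fintype.card_fin, nsmul_eq_mul, Nat.cast_pred i.pos] at h2
  have := P.linearityProb_le_one (S i) i
  have := P.stabilizerProb_le_one (S i) i
  have : P.anticommutationProb (S i) i ≤ anticommutationValue n :=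
    P.anticommutationProb_le (S i) i
  constructor <;> linarith

end Honest

/-! ### From anticommutation to commutation -/

section Commutation

theorem norm_add_five_sq_le {E : Type*} [SeminormedAddCommGroup E] (x y z w v : E) :
    ‖x + y + z + w + v‖ ^ 2 ≤ 5 * (‖x‖ ^ 2 + ‖y‖ ^ 2 + ‖z‖ ^ 2 + ‖w‖ ^ 2 + ‖v‖ ^ 2) := by
  have h : ‖x + y + z + w + v‖ ≤ ‖x‖ + ‖y‖ + ‖z‖ + ‖w‖ + ‖v‖ :=
    (norm_add_le _ _).trans (add_le_add_left norm_add₄_le _)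
  have h2 := pow_le_pow_left₀ (norm_nonneg _) h 2
  nlinarith [sq_nonneg (‖x‖ - ‖y‖), sq_nonneg (‖x‖ - ‖z‖), sq_nonneg (‖x‖ - ‖w‖),
    sq_nonneg (‖x‖ - ‖v‖), sq_nonneg (‖y‖ - ‖z‖), sq_nonneg (‖y‖ - ‖w‖), sq_nonneg (‖y‖ - ‖v‖),
    sq_nonneg (‖z‖ - ‖w‖), sq_nonneg (‖z‖ - ‖v‖), sq_nonneg (‖w‖ - ‖v‖)]

/-- A nonzero string has odd inner product with exactly half of all strings. -/
theorem expect_dotProduct_ne_zero {n : ℕ} {b : Str n} (hb : b ≠ 0) :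
    𝔼 a : Str n, (if a ⬝ᵥ b = 0 then (0 : ℝ) else 1) = 1 / 2 := by
  obtain ⟨k, hk⟩ := Function.ne_iff.1 hb
  have hk1 : b k = 1 := (Strategy.str_zmod_ne_zero _).1 hk
  set g : Str n → ℝ := fun a => if a ⬝ᵥ b = 0 then (0 : ℝ) else 1 with hg
  -- Flipping bit `k` of `a`, where `b k = 1`, changes the parity of `a · b` and preserves the
  -- average.
  have h1 := expect_add_right (Pi.single k 1 : Str n) g
  have h2 : ∀ a, g (a + Pi.single k 1) = 1 - g a := by
    intro a
    have hz : ∀ z : ZMod 2, z + 1 = 0 ↔ ¬ z = 0 := by decide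
    simp only [hg, add_dotProduct, single_dotProduct, hk1, mul_one, hz]
    by_cases h : a ⬝ᵥ b = 0 <;> simp [h]
  simp only [h2, Finset.expect_sub_distrib, Fintype.expect_const] at h1
  linarith

variable {E : Type*} [NormedAddCommGroup E] [InnerProductSpace ℂ E] {n : ℕ}

/-- Linear families that are close to mutually nearly anticommuting operators, with which they
commute exactly, approximately satisfy all the twisted commutation relations. -/
theorem expect_twisted_commutator_sq_le {X Z BX BZ : Str n → E →ₗ[ℂ] E} {ψ : E} {ρ γ : ℝ}
    (hX : ∀ a, IsSymmContraction (X a)) (hZ : ∀ a, IsSymmContraction (Z a))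
    (hBX : ∀ a, IsSymmContraction (BX a)) (hBZ : ∀ a, IsSymmContraction (BZ a))
    (hXX : ∀ a b v, X a (X b v) = X (a + b) v) (hZ0 : ∀ v, Z 0 v = v)
    (cXX : ∀ a b v, X a (BX b v) = BX b (X a v)) (cXZ : ∀ a b v, X a (BZ b v) = BZ b (X a v))
    (cZX : ∀ a b v, Z a (BX b v) = BX b (Z a v))
    (hρX : 𝔼 a, ‖X a ψ - BX a ψ‖ ^ 2 ≤ ρ) (hρZ : 𝔼 b, ‖Z b ψ - BZ b ψ‖ ^ 2 ≤ ρ)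
    (hγ : 𝔼 a, 𝔼 b, (if a ⬝ᵥ b = 0 then 0 else
      ‖BX a (BZ b ψ) + BZ b (BX a ψ)‖ ^ 2) ≤ γ) :
    𝔼 a, 𝔼 b, ‖X a (Z b ψ) - ((-1 : ℂ) ^ (a ⬝ᵥ b).val) • Z b (X a ψ)‖ ^ 2 ≤
      17 * (5 * (4 * ρ + γ)) + 16 * ρ := by
  have sq : ∀ {A : E →ₗ[ℂ] E}, IsSymmContraction A → ∀ v, ‖A v‖ ^ 2 ≤ ‖v‖ ^ 2 :=
    fun hA v => pow_le_pow_left₀ (norm_nonneg _) (hA.norm_le v) 2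
  set T : Str n → Str n → ℝ := fun a b =>
    ‖X a (Z b ψ) - ((-1 : ℂ) ^ (a ⬝ᵥ b).val) • Z b (X a ψ)‖ ^ 2 with hT
  set e : Str n → ℝ := fun a => ‖X a ψ - BX a ψ‖ ^ 2 with he
  set f : Str n → Str n → ℝ := fun a b => if a ⬝ᵥ b = 0 then 0 else T a b with hf
  have hT1 : ∀ a b, a ⬝ᵥ b ≠ 0 → T a b = ‖X a (Z b ψ) + Z b (X a ψ)‖ ^ 2 := by
    intro a b hab
    simp only [hT, (Strategy.str_zmod_ne_zero _).1 hab, show (1 : ZMod 2).val = 1 from rfl, pow_one,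
      neg_one_smul, sub_neg_eq_add]
  have hT0 : ∀ a b, a ⬝ᵥ b = 0 → T a b = ‖X a (Z b ψ) - Z b (X a ψ)‖ ^ 2 := by
    intro a b hab
    simp only [hT, hab, ZMod.val_zero, pow_zero, one_smul]
  have hf0 : ∀ a b, 0 ≤ f a b := by
    intro a b
    simp only [hf, hT]
    split_ifs <;> positivity
  have hfT : ∀ a b, f a b ≤ 5 * (2 * e a + 2 * ‖Z b ψ - BZ b ψ‖ ^ 2
      + if a ⬝ᵥ b = 0 then 0 else ‖BX a (BZ b ψ) + BZ b (BX a ψ)‖ ^ 2) := by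
    intro a b
    by_cases hab : a ⬝ᵥ b = 0
    · simp only [hf, hab, if_true, he]
      positivity
    · simp only [hf, hab, if_false]
      rw [hT1 a b hab]
      -- Exchanging `X`, `Z` for `BX`, `BZ` reverses the order of the factors, which leaves an
      -- anticommutator unchanged.
      have h : X a (Z b ψ) + Z b (X a ψ) = X a (Z b ψ - BZ b ψ) + BZ b (X a ψ - BX a ψ)
          + Z b (X a ψ - BX a ψ) + BX a (Z b ψ - BZ b ψ)
          + (BX a (BZ b ψ) + BZ b (BX a ψ)) := by
        simp only [map_sub, cXZ, cZX]
        abel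
      rw [h]
      refine (norm_add_five_sq_le _ _ _ _ _).trans ?_
      linarith [sq (hX a) (Z b ψ - BZ b ψ), sq (hBZ b) (X a ψ - BX a ψ),
        sq (hZ b) (X a ψ - BX a ψ), sq (hBX a) (Z b ψ - BZ b ψ)]
  have hτ : 𝔼 a, 𝔼 b, f a b ≤ 5 * (4 * ρ + γ) := by
    refine (expect_mono fun a => expect_mono fun b => hfT a b).trans ?_
    simp only [← Finset.mul_expect, Finset.expect_add_distrib, Fintype.expect_const]
    linarith
  have hE0 : 0 ≤ 𝔼 a, e a := expect_nonneg_of_forall fun a => by positivity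
  have hEf0 : ∀ b, 0 ≤ 𝔼 a, f a b := fun b => expect_nonneg_of_forall fun a => hf0 a b
  -- Put `a'' = a' + a`, so that `X a = X a' X a''` and both parts nearly anticommute with `Z b` on
  -- `ψ`. The relation for `a'` is known only on `ψ` itself, so `X a''` is first replaced by `BX
  -- a''`, which can be pulled to the left, and replaced back at the end.
  have htri : ∀ a a' b, a ⬝ᵥ b = 0 → a' ⬝ᵥ b ≠ 0 →
      T a b ≤ 4 * (f a' b + f (a' + a) b + 2 * e (a' + a)) := by
    intro a a' b hab hab'
    have hab'' : (a' + a) ⬝ᵥ b ≠ 0 := by rwa [add_dotProduct, hab, add_zero]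
    simp only [hf, hab', hab'', if_false]
    rw [hT0 a b hab, hT1 _ b hab', hT1 _ b hab'']
    have ha : a = a' + (a' + a) := by rw [← add_assoc, str_add_self, zero_add]
    set a'' := a' + a with ha''
    have hs : ∀ v, X a v = X a' (X a'' v) := fun v => by rw [hXX, ← ha]
    have h : X a (Z b ψ) - Z b (X a ψ) = X a' (X a'' (Z b ψ) + Z b (X a'' ψ))
        + -(X a' (Z b (X a'' ψ - BX a'' ψ))) + -(BX a'' (X a' (Z b ψ) + Z b (X a' ψ)))
        + -(Z b (X a' (X a'' ψ - BX a'' ψ))) := by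
      rw [hs, hs]
      simp only [map_sub, map_add, cXX, cZX]
      abel
    rw [h]
    refine (norm_add_four_sq_le _ _ _ _).trans ?_
    simp only [norm_neg, he]
    linarith [sq (hX a') (X a'' (Z b ψ) + Z b (X a'' ψ)),
      (sq (hX a') (Z b (X a'' ψ - BX a'' ψ))).trans (sq (hZ b) _),
      sq (hBX a'') (X a' (Z b ψ) + Z b (X a' ψ)),
      (sq (hZ b) (X a' (X a'' ψ - BX a'' ψ))).trans (sq (hX a') _)]
  -- Average the previous bound over `a'`. For `b ≠ 0` half of all `a'` qualify, so the constants
  -- double: `2 · 4 · 2 = 16`. For `b = 0` none does, but then `Z b` is the identity.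
  have hmain : ∀ a b, T a b ≤ f a b + 16 * (𝔼 a', f a' b) + 16 * 𝔼 a', e a' := by
    intro a b
    by_cases hab : a ⬝ᵥ b = 0
    · rcases eq_or_ne b 0 with rfl | hb
      · rw [hT0 a 0 hab, hZ0, hZ0, sub_self, norm_zero]
        linarith [hf0 a 0, hEf0 0]
      · have h1 : ∀ a', (if a' ⬝ᵥ b = 0 then (0 : ℝ) else 1) * T a b ≤
            4 * (f a' b + f (a' + a) b + 2 * e (a' + a)) := by
          intro a'
          by_cases h : a' ⬝ᵥ b = 0
          · simp only [h, if_true, zero_mul]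
            have : 0 ≤ e (a' + a) := by positivity
            linarith [hf0 a' b, hf0 (a' + a) b]
          · simp only [h, if_false, one_mul]
            exact htri a a' b hab h
        have h2 := expect_mono h1
        rw [← Finset.expect_mul, expect_dotProduct_ne_zero hb, ← Finset.mul_expect,
          Finset.expect_add_distrib, Finset.expect_add_distrib, ← Finset.mul_expect,
          expect_add_right a fun c => f c b, expect_add_right a e] at h2
        linarith [hf0 a b]
    · have : f a b = T a b := by simp only [hf, hab, if_false]
      linarith [hEf0 b]
  refine (expect_mono fun a => expect_mono fun b => hmain a b).trans ?_
  simp only [Finset.expect_add_distrib, ← Finset.mul_expect, Fintype.expect_const]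
  rw [Finset.expect_comm _ _ (fun b a => f a b)]
  linarith

end Commutation

/-! ### Rounding the marginal observables -/

section Rounding

variable {r n : ℕ} {ι : Fin r → Type*} [∀ j, Fintype (ι j)] [∀ j, DecidableEq (ι j)]

theorem expect_expect_le_sqrt {G : Type*} [Fintype G] [Nonempty G] (f : G → G → ℝ) :
    𝔼 a, 𝔼 b, f a b ≤ √(𝔼 a, 𝔼 b, f a b ^ 2) := by
  refine (expect_mono fun a => expect_le_sqrt_expect_sq (f a)).trans
    ((expect_le_sqrt_expect_sq _).trans (le_of_eq ?_))
  congr 1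
  refine Finset.expect_congr rfl fun a _ => Real.sq_sqrt ?_
  exact expect_nonneg_of_forall fun b => sq_nonneg _

namespace Strategy

variable (P : Strategy r n ι) (s : Fin r → ZMod 2) (i : Fin r)

theorem onProver_compositeObs_comm (m : ℕ) (A : Matrix (ι i × Anc m) (ι i × Anc m) ℂ)
    (N : PBasis) (u : Str n) (v : EuclideanSpace ℂ ((∀ j, ι j) × Anc m)) :
    Matrix.toEuclideanLin (onProver i m A) (Matrix.toEuclideanLin
        (P.compositeObs s i N u ⊗ₖ (1 : Matrix (Anc m) (Anc m) ℂ)) v) =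
      Matrix.toEuclideanLin (P.compositeObs s i N u ⊗ₖ (1 : Matrix (Anc m) (Anc m) ℂ))
        (Matrix.toEuclideanLin (onProver i m A) v) := by
  have h : P.compositeObs s i N u ⊗ₖ (1 : Matrix (Anc m) (Anc m) ℂ) = ((1 : ℂ) / 2 ^ n) •
      ∑ c, P.compositeOp s i N u c ⊗ₖ (1 : Matrix (Anc m) (Anc m) ℂ) := by
    ext x y
    simp [compositeObs, Matrix.kroneckerMap_apply, Matrix.sum_apply, Finset.sum_mul, mul_assoc]
  rw [← toEuclideanLin_mul_apply, ← toEuclideanLin_mul_apply, h]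
  congr 2
  simp only [Matrix.mul_smul, Matrix.smul_mul, Finset.mul_sum, Finset.sum_mul]
  congr 1
  refine Finset.sum_congr rfl fun c _ => ?_
  exact onProver_mul_tensorOp i m A (if_pos rfl)

theorem norm_marginal_mul_sub_sq_le (N : PBasis) (a b : Str n) :
    ‖Matrix.toEuclideanLin (localOp i (P.marginal i N 2 a b)) P.state
        - Matrix.toEuclideanLin (localOp i (P.marginal i N 0 a b))
          (Matrix.toEuclideanLin (localOp i (P.marginal i N 1 a b)) P.state)‖ ^ 2
      ≤ 1 - ‖Matrix.toEuclideanLin (localOp i (P.marginal i N 1 a b)) P.state‖ ^ 2 := by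
  have h := ((P.isPOVM i (Query.pauli N (sortPair a b))).localOp i).norm_signedSum_mul_sub_sq_le
    (fun x => (label a b x).1) (fun x => (label a b x).2) P.state
  rw [← localOp_signedSum, ← localOp_signedSum, ← localOp_signedSum, P.norm_state, one_pow] at h
  exact h

/-- Rounding of a family `H` of marginal observables of prover `i` that is well correlated with the
composite prover to exactly linear observables. -/
theorem exists_rounding {N : PBasis} {η : ℝ} (hη0 : 0 ≤ η) (hη1 : η ≤ 1)
    (hlin : ∀ t, 1 - η ≤ 𝔼 a, 𝔼 b, P.linCorr s i N t a b)
    {H : Str n → Matrix (ι i) (ι i) ℂ}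
    (hH : ∀ a, IsSymmContraction (Matrix.toEuclideanLin (H a)))
    (hHL : ∀ a, IsSymmContraction (Matrix.toEuclideanLin (localOp i (H a))))
    (hcorr : 1 - η ≤ 𝔼 a, (inner ℂ (Matrix.toEuclideanLin (localOp i (H a)) P.state)
      (Matrix.toEuclideanLin (P.compositeObs s i N a) P.state)).re) :
    ∃ X : Str n → Matrix (ι i × Anc (n + 2)) (ι i × Anc (n + 2)) ℂ,
      (∀ a, IsObservable (X a)) ∧ (∀ a b, X a * X b = X (a + b)) ∧
      𝔼 a, ‖Matrix.toEuclideanLin (onProver i (n + 2) (X a)) (withAncilla (n + 2) P.state)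
        - withAncilla (n + 2) (Matrix.toEuclideanLin (P.compositeObs s i N a) P.state)‖ ^ 2
          ≤ 32 * √η ∧
      𝔼 a, P.sqNorm i (n + 2) (X a - H a ⊗ₖ (1 : Matrix (Anc (n + 2)) (Anc (n + 2)) ℂ))
        ≤ 68 * √η := by
  have hHh : ∀ a, (H a).IsHermitian := fun a =>
    Matrix.isSymmetric_toEuclideanLin_iff.1 fun v w => (hH a).symm v w
  obtain ⟨X, hX, hXX, hXc⟩ := exists_linear_observables hHh (posSemidef_one_sub_average_sq hHh hH)
  set ψ := P.state with hψ
  set B := fun a => Matrix.toEuclideanLin (P.compositeObs s i N a) with hB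
  set L := fun a => Matrix.toEuclideanLin (localOp i (H a)) with hL
  have hBc : ∀ a, IsSymmContraction (B a) := P.isSymmContraction_compositeObs s i N
  have hB1 : ∀ a, ‖B a ψ‖ ≤ 1 := fun a => P.norm_state ▸ (hBc a).norm_le ψ
  have hL1 : ∀ a, ‖L a ψ‖ ≤ 1 := fun a => P.norm_state ▸ (hHL a).norm_le ψ
  have happ : 𝔼 a, 𝔼 b, ‖L b (L a ψ) - L (a + b) ψ‖ ^ 2 ≤ 152 * η :=
    expect_norm_apply_apply_sub_sq_le (B := B) (H := L)
      (M₁ := fun a b => Matrix.toEuclideanLin (localOp i (P.marginal i N 0 a b)))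
      (M₂ := fun a b => Matrix.toEuclideanLin (localOp i (P.marginal i N 1 a b)))
      (M₁₂ := fun a b => Matrix.toEuclideanLin (localOp i (P.marginal i N 2 a b)))
      P.norm_state hBc hHL
      (fun a b => P.isSymmContraction_localOp_signObs i _ _)
      (fun a b => P.isSymmContraction_localOp_signObs i _ _)
      (fun a b => P.isSymmContraction_localOp_signObs i _ _)
      (P.norm_marginal_mul_sub_sq_le i N)
      (fun a b => P.localOp_compositeObs_comm s i _ N b)
      (fun a b c => P.localOp_compositeObs_comm s i _ N c)
      (hlin 0) (hlin 1) (hlin 2) hcorr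
  -- Substitute `a + b` for `a` and use `b + b = 0`; this is the form in which the dilation produces
  -- the products.
  have happ' : 𝔼 a, 𝔼 b, ‖L b (L (a + b) ψ) - L a ψ‖ ^ 2 ≤ 152 * η := by
    refine le_of_eq_of_le ?_ happ
    rw [Finset.expect_comm, Finset.expect_comm Finset.univ Finset.univ
      fun a b => ‖L b (L a ψ) - L (a + b) ψ‖ ^ 2]
    refine Finset.expect_congr rfl fun b _ => ?_
    rw [← expect_add_right b fun a => ‖L b (L a ψ) - L (a + b) ψ‖ ^ 2]
    refine Finset.expect_congr rfl fun a _ => ?_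
    rw [add_assoc a b b, str_add_self, add_zero]
  have hclose : 𝔼 a, ‖L a ψ - B a ψ‖ ^ 2 ≤ 2 * η := expect_norm_sub_sq_le hL1 hB1 hcorr
  have hsq : 𝔼 a, ‖L a (L a ψ) - ψ‖ ^ 2 ≤ 2 * η := by
    have : ∀ a, ‖L a (L a ψ) - ψ‖ ^ 2 ≤ 2 * (1 - (inner ℂ (L a ψ) (B a ψ)).re) := by
      intro a
      refine ((hHL a).norm_apply_apply_sub_sq_le ψ).trans ?_
      rw [P.norm_state]
      have e1 := (abs_le.1 (abs_re_inner_le_norm (L a ψ) (B a ψ))).2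
      have e2 := hB1 a
      have e3 : ‖L a ψ‖ * ‖B a ψ‖ ≤ ‖L a ψ‖ := mul_le_of_le_one_right (norm_nonneg _) e2
      change 1 ^ 2 - ‖L a ψ‖ ^ 2 ≤ _
      nlinarith [sq_nonneg (1 - ‖L a ψ‖)]
    refine (expect_mono this).trans ?_
    rw [← Finset.mul_expect, Finset.expect_sub_distrib, Fintype.expect_const]
    linarith
  -- By the formula for the compression, the dilated observable differs from `L a` on `ψ` by the two
  -- averages that approximate linearity and `L b (L b ψ) ≈ ψ` control.
  have hinner : ∀ a, (inner ℂ (L a ψ) (B a ψ)).re - (𝔼 b, ‖L b (L (a + b) ψ) - L a ψ‖)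
        - (𝔼 b, ‖L b (L b ψ) - ψ‖) ≤
      (inner ℂ (Matrix.toEuclideanLin (onProver i (n + 2) (X a)) (withAncilla (n + 2) ψ))
        (withAncilla (n + 2) (B a ψ))).re := by
    intro a
    rw [inner_onProver_withAncilla, hXc]
    have e : Matrix.toEuclideanLin (localOp i (((1 : ℂ) / 2 ^ n) • ∑ b, H b * H (a + b)
          + (1 - ((1 : ℂ) / 2 ^ n) • ∑ b, H b * H b))) ψ =
        ((1 : ℂ) / 2 ^ n) • ∑ b, L b (L (a + b) ψ)
          + (ψ - ((1 : ℂ) / 2 ^ n) • ∑ b, L b (L b ψ)) := by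
      simp only [map_add, map_sub, map_smul, map_sum, map_mul, map_one, LinearMap.add_apply,
        LinearMap.sub_apply, LinearMap.smul_apply, LinearMap.sum_apply, toEuclideanLin_mul_apply,
        toEuclideanLin_one_apply, hL]
    rw [e, inner_add_left, inner_sub_left, Complex.add_re, Complex.sub_re, re_inner_average_left,
      re_inner_average_left]
    have b1 : (inner ℂ (L a ψ) (B a ψ)).re - (𝔼 b, ‖L b (L (a + b) ψ) - L a ψ‖) ≤
        𝔼 b, (inner ℂ (L b (L (a + b) ψ)) (B a ψ)).re := by
      rw [← Fintype.expect_const (ι := Str n) (inner ℂ (L a ψ) (B a ψ)).re,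
        ← Finset.expect_sub_distrib]
      refine expect_mono fun b => ?_
      have h1 := (abs_le.1 (abs_re_inner_le_norm (L b (L (a + b) ψ) - L a ψ) (B a ψ))).1
      rw [inner_sub_left, Complex.sub_re] at h1
      have h2 := mul_le_of_le_one_right (norm_nonneg (L b (L (a + b) ψ) - L a ψ)) (hB1 a)
      linarith
    have b2 : (𝔼 b, (inner ℂ (L b (L b ψ)) (B a ψ)).re) - (inner ℂ ψ (B a ψ)).re ≤
        𝔼 b, ‖L b (L b ψ) - ψ‖ := by
      rw [← Fintype.expect_const (ι := Str n) (inner ℂ ψ (B a ψ)).re,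
        ← Finset.expect_sub_distrib]
      refine expect_mono fun b => ?_
      have h1 := (abs_le.1 (abs_re_inner_le_norm (L b (L b ψ) - ψ) (B a ψ))).2
      rw [inner_sub_left, Complex.sub_re] at h1
      have h2 := mul_le_of_le_one_right (norm_nonneg (L b (L b ψ) - ψ)) (hB1 a)
      linarith
    linarith
  have hηs : η ≤ √η := Real.le_sqrt_of_sq_le (by nlinarith)
  have hs1 : √(152 * η) ≤ 13 * √η := by
    rw [Real.sqrt_le_left (by positivity), mul_pow, Real.sq_sqrt hη0]
    linarith
  have hs2 : √(2 * η) ≤ 2 * √η := by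
    rw [Real.sqrt_le_left (by positivity), mul_pow, Real.sq_sqrt hη0]
    linarith
  have hXn : ∀ a, ‖Matrix.toEuclideanLin (onProver i (n + 2) (X a)) (withAncilla (n + 2) ψ)‖ ≤ 1 :=
    fun a => ((hX a).onProver.isSymmContraction.norm_le _).trans
      (by rw [norm_withAncilla]; exact P.norm_state.le)
  -- Norms enter here unsquared, whence the square root. The average correlation is at least `1 - η
  -- - 13√η - 2√η ≥ 1 - 16√η`.
  have hρ : 𝔼 a, ‖Matrix.toEuclideanLin (onProver i (n + 2) (X a)) (withAncilla (n + 2) ψ)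
        - withAncilla (n + 2) (B a ψ)‖ ^ 2 ≤ 32 * √η := by
    refine (expect_norm_sub_sq_le (η := 16 * √η) hXn
      (fun a => by rw [norm_withAncilla]; exact hB1 a) ?_).trans (by linarith)
    refine le_trans ?_ (expect_mono hinner)
    rw [Finset.expect_sub_distrib, Finset.expect_sub_distrib, Fintype.expect_const]
    have t1 := (expect_expect_le_sqrt fun a b => ‖L b (L (a + b) ψ) - L a ψ‖).trans
      ((Real.sqrt_le_sqrt happ').trans hs1)
    have t2 := (expect_le_sqrt_expect_sq fun a => ‖L a (L a ψ) - ψ‖).trans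
      ((Real.sqrt_le_sqrt hsq).trans hs2)
    linarith
  refine ⟨X, hX, hXX, hρ, ?_⟩
  have hfin : ∀ a, P.sqNorm i (n + 2) (X a - H a ⊗ₖ (1 : Matrix (Anc (n + 2)) (Anc (n + 2)) ℂ)) ≤
      2 * (‖Matrix.toEuclideanLin (onProver i (n + 2) (X a)) (withAncilla (n + 2) ψ)
        - withAncilla (n + 2) (B a ψ)‖ ^ 2 + ‖L a ψ - B a ψ‖ ^ 2) := by
    intro a
    unfold sqNorm opApply
    rw [onProver_sub, onProver_kronecker_one, map_sub, LinearMap.sub_apply,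
      toEuclideanLin_kronecker_one_withAncilla]
    rw [← norm_withAncilla (n + 2) (L a ψ - B a ψ), withAncilla_sub]
    set u := Matrix.toEuclideanLin (onProver i (n + 2) (X a)) (withAncilla (n + 2) ψ)
    set v := withAncilla (n + 2) (B a ψ)
    set w := withAncilla (n + 2) (L a ψ)
    have h1 : ‖u - w‖ ≤ ‖u - v‖ + ‖w - v‖ := by
      rw [norm_sub_rev w v]
      exact norm_sub_le_norm_sub_add_norm_sub u v w
    exact (pow_le_pow_left₀ (norm_nonneg _) h1 2).trans add_sq_le
  refine (expect_mono hfin).trans ?_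
  rw [← Finset.mul_expect, Finset.expect_add_distrib]
  linarith

end Strategy

end Rounding

/-! ### The quantum linearity test -/

section LinearityTest

theorem one_sub_card_mul_le {κ : Type*} [Fintype κ] {v : κ → ℝ} {δ : ℝ} (hv : ∀ x, v x ≤ 1)
    (h : 1 - δ ≤ 𝔼 x, v x) (x : κ) : 1 - Fintype.card κ * δ ≤ v x := by
  have hc : (0 : ℝ) < Fintype.card κ := by exact_mod_cast Fintype.card_pos_iff.2 ⟨x⟩
  rw [Fintype.expect_eq_sum_div_card, le_div_iff₀ hc] at h
  have h2 := Finset.single_le_sum (f := fun y => 1 - v y) (fun y _ => sub_nonneg.2 (hv y))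
    (Finset.mem_univ x)
  rw [Finset.sum_sub_distrib, Finset.sum_const, Finset.card_univ, nsmul_eq_mul] at h2
  linarith

variable {r n : ℕ} {ι : Fin r → Type*} [∀ j, Fintype (ι j)] [∀ j, DecidableEq (ι j)]

namespace Strategy

variable (P : Strategy r n ι) (s : Fin r → ZMod 2) (i : Fin r)

/-- Each of the `2 · 3` choices of `N` and `t` loses at most `6δ` of probability, hence `12δ` of
correlation. -/
theorem expect_linCorr_ge {δ : ℝ} (h : 1 - δ ≤ P.linearityProb s i) (N : PBasis) (t : Fin 3) :
    1 - 12 * δ ≤ 𝔼 a, 𝔼 b, P.linCorr s i N t a b := by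
  have e : P.linearityProb s i =
      𝔼 N, 𝔼 t, (1 + 𝔼 a, 𝔼 b, P.linCorr s i N t a b) / 2 := by
    rw [linearityProb_eq]
    refine Finset.expect_congr rfl fun N _ => (expect_rotate _).trans ?_
    simp only [← Finset.expect_div, Finset.expect_add_distrib, Fintype.expect_const]
  have hle : ∀ N t, (1 + 𝔼 a, 𝔼 b, P.linCorr s i N t a b) / 2 ≤ 1 := by
    intro N t
    have : 𝔼 a, 𝔼 b, P.linCorr s i N t a b ≤ 1 :=
      Finset.expect_le Finset.univ_nonempty fun a _ => Finset.expect_le Finset.univ_nonempty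
        fun b _ => P.linCorr_le_one s i N t a b
    linarith
  rw [e] at h
  have h1 := one_sub_card_mul_le (fun N => Finset.expect_le Finset.univ_nonempty
    fun t _ => hle N t) h N
  have h2 := one_sub_card_mul_le (hle N) h1 t
  rw [show Fintype.card PBasis = 2 from rfl, Fintype.card_fin] at h2
  push_cast at h2
  linarith

/-- The factor is `100` from rigidity times `8` from the dependence of the success probability on
`chsh`. -/
theorem expect_anticommutator_sq_le {δ : ℝ}
    (h : anticommutationValue n - δ ≤ P.anticommutationProb s i) :
    𝔼 a, 𝔼 b, (if a ⬝ᵥ b = 0 then 0 else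
      ‖Matrix.toEuclideanLin (P.compositeObs s i PBasis.X a)
          (Matrix.toEuclideanLin (P.compositeObs s i PBasis.Z b) P.state)
        + Matrix.toEuclideanLin (P.compositeObs s i PBasis.Z b)
          (Matrix.toEuclideanLin (P.compositeObs s i PBasis.X a) P.state)‖ ^ 2) ≤ 800 * δ := by
  have hp : ∀ a b : Str n, (if a ⬝ᵥ b = 0 then 0 else
      ‖Matrix.toEuclideanLin (P.compositeObs s i PBasis.X a)
          (Matrix.toEuclideanLin (P.compositeObs s i PBasis.Z b) P.state)
        + Matrix.toEuclideanLin (P.compositeObs s i PBasis.Z b)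
          (Matrix.toEuclideanLin (P.compositeObs s i PBasis.X a) P.state)‖ ^ 2) ≤
      800 * ((if a ⬝ᵥ b = 0 then 1 else 1 / 2 + √2 / 4)
        - if a ⬝ᵥ b = 0 then 1 else 1 / 2 + P.chsh s i a b / 8) := by
    intro a b
    split_ifs
    · simp
    · linarith [P.anticommutator_sq_le s i a b]
  refine (expect_mono fun a => expect_mono fun b => hp a b).trans ?_
  simp only [← Finset.mul_expect, Finset.expect_sub_distrib]
  rw [← anticommutationProb_eq]
  unfold anticommutationValue at h
  linarith

theorem isSymmContraction_average_signObs (q : Str n → Query n)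
    (f : Str n → ℤˣ × ℤˣ → ℤˣ) :
    IsSymmContraction (Matrix.toEuclideanLin
      (((1 : ℂ) / 2 ^ n) • ∑ c, P.signObs i (q c) (f c))) := by
  rw [map_smul, map_sum]
  exact isSymmContraction_average fun c => (P.isPOVM i (q c)).isSymmContraction_signedSum (f c)

theorem isSymmContraction_localOp_average_signObs (q : Str n → Query n)
    (f : Str n → ℤˣ × ℤˣ → ℤˣ) :
    IsSymmContraction (Matrix.toEuclideanLin
      (localOp i (((1 : ℂ) / 2 ^ n) • ∑ c, P.signObs i (q c) (f c)))) := by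
  rw [map_smul, map_sum, map_smul, map_sum]
  exact isSymmContraction_average fun c => P.isSymmContraction_localOp_signObs i (q c) (f c)

theorem isSymmContraction_hatX (a : Str n) :
    IsSymmContraction (Matrix.toEuclideanLin (P.hatX i a)) := by
  rw [hatX_eq]
  exact P.isSymmContraction_average_signObs i _ _

theorem isSymmContraction_hatZ (b : Str n) :
    IsSymmContraction (Matrix.toEuclideanLin (P.hatZ i b)) := by
  rw [hatZ_eq]
  exact P.isSymmContraction_average_signObs i _ _

theorem isSymmContraction_localOp_hatX (a : Str n) :
    IsSymmContraction (Matrix.toEuclideanLin (localOp i (P.hatX i a))) := by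
  rw [hatX_eq]
  exact P.isSymmContraction_localOp_average_signObs i _ _

theorem isSymmContraction_localOp_hatZ (b : Str n) :
    IsSymmContraction (Matrix.toEuclideanLin (localOp i (P.hatZ i b))) := by
  rw [hatZ_eq]
  exact P.isSymmContraction_localOp_average_signObs i _ _

theorem expect_inner_hatX :
    𝔼 a, (inner ℂ (Matrix.toEuclideanLin (localOp i (P.hatX i a)) P.state)
      (Matrix.toEuclideanLin (P.compositeObs s i PBasis.X a) P.state)).re =
    𝔼 a, 𝔼 b, P.linCorr s i PBasis.X 0 a b := by
  refine Finset.expect_congr rfl fun a _ => ?_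
  rw [hatX_eq, map_smul, map_sum, map_smul, map_sum, LinearMap.smul_apply, LinearMap.sum_apply,
    re_inner_average_left]
  rfl

theorem expect_inner_hatZ :
    𝔼 b, (inner ℂ (Matrix.toEuclideanLin (localOp i (P.hatZ i b)) P.state)
      (Matrix.toEuclideanLin (P.compositeObs s i PBasis.Z b) P.state)).re =
    𝔼 a, 𝔼 b, P.linCorr s i PBasis.Z 1 a b := by
  rw [Finset.expect_comm]
  refine Finset.expect_congr rfl fun b _ => ?_
  rw [hatZ_eq, map_smul, map_sum, map_smul, map_sum, LinearMap.smul_apply, LinearMap.sum_apply,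
    re_inner_average_left]
  rfl

/-- Exactly linear observables close to the marginal observables, from the loss `δ` in the linearity
test and in the anticommutation test. -/
theorem exists_linear_observables_of_tests {δ : ℝ} (hδ0 : 0 ≤ δ) (hδ1 : 12 * δ ≤ 1)
    (hlin : 1 - δ ≤ P.linearityProb s i)
    (hac : anticommutationValue n - δ ≤ P.anticommutationProb s i) :
    ∃ X Z : Str n → Matrix (ι i × Anc (n + 2)) (ι i × Anc (n + 2)) ℂ,
      (∀ a, IsObservable (X a)) ∧ (∀ a, IsObservable (Z a)) ∧
      (∀ a b, X a * X b = X (a + b)) ∧ (∀ a b, Z a * Z b = Z (a + b)) ∧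
      𝔼 a, 𝔼 b, P.sqNorm i (n + 2) (X a * Z b - ((-1 : ℂ) ^ (a ⬝ᵥ b).val) • (Z b * X a)) ≤
        17087 * √(12 * δ) ∧
      𝔼 a, P.sqNorm i (n + 2)
        (X a - P.hatX i a ⊗ₖ (1 : Matrix (Anc (n + 2)) (Anc (n + 2)) ℂ)) ≤ 68 * √(12 * δ) ∧
      𝔼 b, P.sqNorm i (n + 2)
        (Z b - P.hatZ i b ⊗ₖ (1 : Matrix (Anc (n + 2)) (Anc (n + 2)) ℂ)) ≤ 68 * √(12 * δ) := by
  set η := 12 * δ with hη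
  have hη0 : 0 ≤ η := by positivity
  have hcorr := P.expect_linCorr_ge s i hlin
  obtain ⟨X, hX, hXX, hXB, hXH⟩ := P.exists_rounding s i hη0 hδ1 (hcorr PBasis.X)
    (P.isSymmContraction_hatX i) (P.isSymmContraction_localOp_hatX i)
    (by rw [expect_inner_hatX]; exact hcorr PBasis.X 0)
  obtain ⟨Z, hZ, hZZ, hZB, hZH⟩ := P.exists_rounding s i hη0 hδ1 (hcorr PBasis.Z)
    (P.isSymmContraction_hatZ i) (P.isSymmContraction_localOp_hatZ i)
    (by rw [expect_inner_hatZ]; exact hcorr PBasis.Z 1)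
  refine ⟨X, Z, hX, hZ, hXX, hZZ, ?_, hXH, hZH⟩
  have hZ0 : Z 0 = 1 := by
    rw [← (hZ 0).2, hZZ, add_zero]
  have hcomm := P.onProver_compositeObs_comm s i (n + 2)
  have hanti := P.expect_anticommutator_sq_le s i hac
  have h := expect_twisted_commutator_sq_le
    (X := fun a => Matrix.toEuclideanLin (onProver i (n + 2) (X a)))
    (Z := fun a => Matrix.toEuclideanLin (onProver i (n + 2) (Z a)))
    (BX := fun a => Matrix.toEuclideanLin (P.compositeObs s i PBasis.X a ⊗ₖ
      (1 : Matrix (Anc (n + 2)) (Anc (n + 2)) ℂ)))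
    (BZ := fun a => Matrix.toEuclideanLin (P.compositeObs s i PBasis.Z a ⊗ₖ
      (1 : Matrix (Anc (n + 2)) (Anc (n + 2)) ℂ)))
    (ψ := withAncilla (n + 2) P.state) (ρ := 32 * √η) (γ := 800 * δ)
    (fun a => (hX a).onProver.isSymmContraction) (fun a => (hZ a).onProver.isSymmContraction)
    (fun a => (P.isSymmContraction_compositeObs s i PBasis.X a).kronecker_one)
    (fun a => (P.isSymmContraction_compositeObs s i PBasis.Z a).kronecker_one)
    (fun a b v => by rw [← toEuclideanLin_mul_apply, ← onProver_mul, hXX])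
    (fun v => by rw [hZ0, onProver_one, toEuclideanLin_one_apply])
    (fun a b v => hcomm (X a) PBasis.X b v) (fun a b v => hcomm (X a) PBasis.Z b v)
    (fun a b v => hcomm (Z a) PBasis.X b v)
    (by simpa only [toEuclideanLin_kronecker_one_withAncilla] using hXB)
    (by simpa only [toEuclideanLin_kronecker_one_withAncilla] using hZB)
    (by simpa only [toEuclideanLin_kronecker_one_withAncilla, ← withAncilla_add,
      norm_withAncilla] using hanti)
  have e : ∀ a b, P.sqNorm i (n + 2)
      (X a * Z b - ((-1 : ℂ) ^ (a ⬝ᵥ b).val) • (Z b * X a)) =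
      ‖Matrix.toEuclideanLin (onProver i (n + 2) (X a)) (Matrix.toEuclideanLin
          (onProver i (n + 2) (Z b)) (withAncilla (n + 2) P.state))
        - ((-1 : ℂ) ^ (a ⬝ᵥ b).val) • Matrix.toEuclideanLin (onProver i (n + 2) (Z b))
          (Matrix.toEuclideanLin (onProver i (n + 2) (X a)) (withAncilla (n + 2) P.state))‖ ^ 2 := by
    intro a b
    unfold sqNorm opApply
    rw [onProver_sub, onProver_smul, onProver_mul, onProver_mul, map_sub, map_smul,
      LinearMap.sub_apply, LinearMap.smul_apply, toEuclideanLin_mul_apply,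
      toEuclideanLin_mul_apply]
  simp only [e]
  have hηs : η ≤ √η := Real.le_sqrt_of_sq_le (by nlinarith)
  -- The constant `17087` exceeds `17 · 5 · (4 · 32 + 800/12) + 16 · 32`, using `δ = η/12` and `η ≤
  -- √η`.
  linarith

theorem sqNorm_one_sub_le (m : ℕ) {A : Matrix (ι i × Anc m) (ι i × Anc m) ℂ}
    (hA : ‖Matrix.toEuclideanLin (onProver i m A) (withAncilla m P.state)‖ ≤ 1) :
    P.sqNorm i m (1 - A) ≤ 4 := by
  have h : ‖Matrix.toEuclideanLin (onProver i m (1 - A)) (withAncilla m P.state)‖ ≤ 2 := by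
    rw [onProver_sub, onProver_one, map_sub, LinearMap.sub_apply, toEuclideanLin_one_apply]
    refine (norm_sub_le _ _).trans ?_
    rw [norm_withAncilla, P.norm_state]
    linarith
  exact (pow_le_pow_left₀ (norm_nonneg _) h 2).trans (by norm_num)

theorem norm_onProver_kronecker_one_le (m : ℕ) {A : Matrix (ι i) (ι i) ℂ}
    (hA : IsSymmContraction (Matrix.toEuclideanLin (localOp i A))) :
    ‖Matrix.toEuclideanLin (onProver i m (A ⊗ₖ (1 : Matrix (Anc m) (Anc m) ℂ)))
      (withAncilla m P.state)‖ ≤ 1 := by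
  rw [onProver_kronecker_one, toEuclideanLin_kronecker_one_withAncilla, norm_withAncilla]
  exact (hA.norm_le _).trans P.norm_state.le

end Strategy

theorem expect_str_eq (f : Str n → ℝ) : (1 / (2 : ℝ) ^ n) * ∑ a, f a = 𝔼 a, f a := by
  rw [Fintype.expect_eq_sum_div_card, Fintype.card_fun, ZMod.card, Fintype.card_fin]
  push_cast
  ring

theorem expect_expect_str_eq (f : Str n → Str n → ℝ) :
    (1 / (2 : ℝ) ^ (2 * n)) * ∑ a, ∑ b, f a b = 𝔼 a, 𝔼 b, f a b := by
  simp only [← expect_str_eq, ← Finset.mul_sum]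
  rw [← mul_assoc, two_mul, pow_add, one_div_mul_one_div]

end LinearityTest

theorem lemma4p1 (r : ℕ) :
    ∃ K : ℝ, 0 < K ∧
      ∀ (C : CSSCode r) (S : Fin r → Fin r → ZMod 2), C.IsChoice S →
      ∀ (n : ℕ) (φ : EuclideanSpace ℂ (Fin r → Fin n → Fin 2)) (hφ : C.IsEncoded φ)
        (ι : Fin r → Type*) [∀ j, Fintype (ι j)] [∀ j, DecidableEq (ι j)]
        (P : Strategy r n ι) (ε : ℝ), 0 ≤ ε →
        (honestStrategy φ hφ.1).encodeProb S - ε ≤ P.encodeProb S →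
      ∀ i : Fin r,
        ∃ (m : ℕ) (Xlin Zlin : Str n → Matrix (ι i × Anc m) (ι i × Anc m) ℂ),
          (∀ a, IsObservable (Xlin a)) ∧ (∀ a, IsObservable (Zlin a)) ∧
          (∀ a b, Xlin a * Xlin b = Xlin (a + b)) ∧
          (∀ a b, Zlin a * Zlin b = Zlin (a + b)) ∧
          (1 / (2 : ℝ) ^ (2 * n)) * ∑ a : Str n, ∑ b : Str n,
            P.sqNorm i m (Xlin a * Zlin b
              - ((-1 : ℂ) ^ (a ⬝ᵥ b).val) • (Zlin b * Xlin a)) ≤ K * ε ^ ((1 : ℝ) / 4) ∧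
          (1 / (2 : ℝ) ^ n) * ∑ a : Str n,
            P.sqNorm i m (Xlin a - P.hatX i a ⊗ₖ (1 : Matrix (Anc m) (Anc m) ℂ))
              ≤ K * ε ^ ((1 : ℝ) / 4) ∧
          (1 / (2 : ℝ) ^ n) * ∑ b : Str n,
            P.sqNorm i m (Zlin b - P.hatZ i b ⊗ₖ (1 : Matrix (Anc m) (Anc m) ℂ))
              ≤ K * ε ^ ((1 : ℝ) / 4) := by
  -- The largest constant, `17087`, is multiplied by the `6r` that bounds `√(36rε)`, and `6 · 17087
  -- < 110000`.
  refine ⟨110000 * (r + 1), by positivity, ?_⟩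
  intro C S hS n φ hφ ι _ _ P ε hε h i
  obtain ⟨hlin, hac⟩ := P.tests_of_encodeProb hφ hS h i
  simp only [expect_str_eq, expect_expect_str_eq]
  have hr : (1 : ℝ) ≤ r := by exact_mod_cast i.pos
  by_cases hsmall : 12 * (3 * r * ε) ≤ 1
  · obtain ⟨X, Z, hX, hZ, hXX, hZZ, h1, h2, h3⟩ :=
      P.exists_linear_observables_of_tests (S i) i (by positivity) hsmall hlin hac
    have hε1 : ε ≤ 1 := by nlinarith
    have hs : √(12 * (3 * r * ε)) ≤ 6 * r * ε ^ ((1 : ℝ) / 4) := by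
      have e1 : √(12 * (3 * r * ε)) ≤ 6 * r * √ε := by
        rw [Real.sqrt_le_left (by positivity), mul_pow, Real.sq_sqrt hε]
        nlinarith [mul_nonneg (sub_nonneg.2 hr) hε, mul_nonneg (mul_nonneg (sub_nonneg.2 hr) hε)
          (zero_le_one.trans hr)]
      have e2 : √ε ≤ ε ^ ((1 : ℝ) / 4) := by
        rw [Real.sqrt_eq_rpow]
        exact Real.rpow_le_rpow_of_exponent_ge_of_imp hε hε1 (by norm_num) (by norm_num)
      exact e1.trans (mul_le_mul_of_nonneg_left e2 (by positivity))
    have hp : 0 ≤ ε ^ ((1 : ℝ) / 4) := Real.rpow_nonneg hε _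
    have hrp : 0 ≤ r * ε ^ ((1 : ℝ) / 4) := by positivity
    exact ⟨n + 2, X, Z, hX, hZ, hXX, hZZ, by linarith, by linarith, by linarith⟩
  -- Here `ε > 1/(36r)`, so the allowed error exceeds `4`, the largest possible squared distance
  -- between two vectors of norm at most `1`. Identity observables without ancillas suffice.
  · push Not at hsmall
    have hbig : 4 ≤ 110000 * ((r : ℝ) + 1) * ε ^ ((1 : ℝ) / 4) := by
      rcases le_total ε 1 with hε1 | hε1
      · have e : ε ≤ ε ^ ((1 : ℝ) / 4) := Real.self_le_rpow_of_le_one hε hε1 (by norm_num)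
        nlinarith
      · have e : 1 ≤ ε ^ ((1 : ℝ) / 4) := Real.one_le_rpow hε1 (by norm_num)
        nlinarith
    have hone : IsObservable (1 : Matrix (ι i × Anc 0) (ι i × Anc 0) ℂ) :=
      ⟨Matrix.isHermitian_one, Matrix.one_mul 1⟩
    refine ⟨0, fun _ => 1, fun _ => 1, fun _ => hone, fun _ => hone, fun _ _ => Matrix.one_mul 1,
      fun _ _ => Matrix.one_mul 1, ?_, ?_, ?_⟩
    · refine le_trans (Finset.expect_le Finset.univ_nonempty fun a _ =>
        Finset.expect_le Finset.univ_nonempty fun b _ => ?_) hbig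
      rw [Matrix.one_mul]
      refine P.sqNorm_one_sub_le i 0 ?_
      rw [onProver_smul, onProver_one, map_smul, LinearMap.smul_apply, toEuclideanLin_one_apply,
        norm_smul, norm_withAncilla, P.norm_state]
      simp
    · exact (Finset.expect_le Finset.univ_nonempty fun a _ => P.sqNorm_one_sub_le i 0
        (P.norm_onProver_kronecker_one_le i 0 (P.isSymmContraction_localOp_hatX i a))).trans hbig
    · exact (Finset.expect_le Finset.univ_nonempty fun a _ => P.sqNorm_one_sub_le i 0
        (P.norm_onProver_kronecker_one_le i 0 (P.isSymmContraction_localOp_hatZ i a))).trans hbig
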